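/- Let $d\ge 6$, let $\mathcal T_d$ be the $d$-regular (unrooted) tree, and let $c:E\mathcal T_d\to[d]=\{0,\dots,d-1\}$ be a coloring of its edges such that, for every vertex $v$, the restriction $c_v$ of $c$ to the set $E(v)$ of edges containing $v$ is a bijection onto $[d]$. Equip $\mathrm{Aut}(\mathcal T_d)$ with the topology of pointwise convergence on vertices, and its subgroups with the subspace topology. For $g\in\mathrm{Aut}(\mathcal T_d)$ write $g_v:E(v)\to E(g.v)$ for the bijection induced by $g$. For a subgroup $F$ of the symmetric group $\mathfrak S_d$ on $[d]$, let $$U(F):=\{g\in\mathrm{Aut}(\mathcal T_d)\mid c_{g.v}\circ g_v\circ c_v^{-1}\in F\text{ for all vertices }v\},$$ and let $U(F)^+$ be the subgroup of $U(F)$ generated by the pointwise stabilizers in $U(F)$ of the edges of $\mathcal T_d$. Suppose that $F\le\mathfrak S_d$ is perfect, $2$-transitive on $[d]$, and generated by its point stabilizers, and that the point stabilizers of $F$ are also perfect. Then every commensurated subgroup $H$ of $U(F)^+$ (that is, every subgroup $H\le U(F)^+$ such that $H\cap gHg^{-1}$ has finite index in both $H$ and $gHg^{-1}$ for all $g\in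 U(F)^+$) is either finite, or compact and open in $U(F)^+$, or equal to $U(F)^+$. -/

import Mathlib

namespace BurgerMozes

variable {V : Type*} {T : SimpleGraph V} {d : ℕ}

/-- The set `E(v)` of edges of `T` containing the vertex `v`. -/
abbrev EdgesAt (T : SimpleGraph V) (v : V) : Type _ :=
  {e : T.edgeSet // v ∈ (e : Sym2 V)}

/-- A coloring `c : E(T) → {0, …, d-1}` whose restriction to `E(v)` is a bijection onto
`{0, …, d-1}` for every vertex `v`. -/
structure Coloring (T : SimpleGraph V) (d : ℕ) where
  /-- the color of an edge -/
  color : T.edgeSet → Fin d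
  bijective_color : ∀ v : V, Function.Bijective fun e : EdgesAt T v => color e.1

/-- The bijection `c_v : E(v) → {0, …, d-1}`. -/
noncomputable def Coloring.colorAt (c : Coloring T d) (v : V) : EdgesAt T v ≃ Fin d :=
  Equiv.ofBijective (fun e : EdgesAt T v => c.color e.1) (c.bijective_color v)

/-- The bijection `g_v : E(v) → E(g v)` induced by an automorphism `g` of `T`. -/
def edgesAtMap (g : T ≃g T) (v : V) : EdgesAt T v ≃ EdgesAt T (g v) :=
  g.mapEdgeSet.subtypeEquiv fun e => by
    constructor
    · intro h
      exact Sym2.mem_map.2 ⟨v, h, rfl⟩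
    · intro h
      obtain ⟨w, hw, hwv⟩ := Sym2.mem_map.1 h
      have hwv' : w = v := g.injective hwv
      exact hwv' ▸ hw

/-- The local permutation `c_{g v} ∘ g_v ∘ c_v⁻¹` of `{0, …, d-1}`. -/
noncomputable def localPerm (c : Coloring T d) (g : T ≃g T) (v : V) : Equiv.Perm (Fin d) :=
  (c.colorAt v).symm.trans ((edgesAtMap g v).trans (c.colorAt (g v)))

theorem localPerm_colorAt (c : Coloring T d) (g : T ≃g T) (v : V) (e : EdgesAt T v) :
    localPerm c g v (c.colorAt v e) = c.colorAt (g v) (edgesAtMap g v e) := by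
  simp [localPerm]

theorem localPerm_one (c : Coloring T d) (v : V) : localPerm c (1 : T ≃g T) v = 1 := by
  ext i
  obtain ⟨e, rfl⟩ := (c.colorAt v).surjective i
  rw [localPerm_colorAt]
  have h : edgesAtMap (1 : T ≃g T) v e = e :=
    Subtype.ext (Subtype.ext (congrFun Sym2.map_id (e.1 : Sym2 V)))
  exact congrArg (fun x => (c.colorAt v x : ℕ)) h

theorem localPerm_mul (c : Coloring T d) (g h : T ≃g T) (v : V) :
    localPerm c (g * h) v = localPerm c g (h v) * localPerm c h v := by
  ext i
  obtain ⟨e, rfl⟩ := (c.colorAt v).surjective i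
  rw [Equiv.Perm.mul_apply, localPerm_colorAt, localPerm_colorAt, localPerm_colorAt]
  have h' : edgesAtMap (g * h) v e = edgesAtMap g (h v) (edgesAtMap h v e) :=
    Subtype.ext (Subtype.ext (Sym2.map_map (g := g) (f := h) (e.1 : Sym2 V)).symm)
  exact congrArg (fun x => (c.colorAt (g (h v)) x : ℕ)) h'

/-- The Burger--Mozes universal group `U(F)`, as a subgroup of `Aut(T)`. -/
noncomputable def universalGroup (c : Coloring T d) (F : Subgroup (Equiv.Perm (Fin d))) :
    Subgroup (T ≃g T) where
  carrier := {g | ∀ v : V, localPerm c g v ∈ F}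
  one_mem' := fun v => by
    rw [localPerm_one]
    exact F.one_mem
  mul_mem' := fun {g h} hg hh v => by
    rw [localPerm_mul]
    exact F.mul_mem (hg _) (hh _)
  inv_mem' := fun {g} hg v => by
    have h1 : localPerm c g (g⁻¹ v) * localPerm c g⁻¹ v = 1 := by
      rw [← localPerm_mul, mul_inv_cancel, localPerm_one]
    rw [eq_inv_of_mul_eq_one_right h1]
    exact F.inv_mem (hg _)

/-- The subgroup `U(F)⁺` of `U(F)` generated by the pointwise stabilizers in `U(F)` of the edges
of `T`, viewed as a subgroup of `Aut(T)`. -/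
noncomputable def universalGroupPlus (c : Coloring T d) (F : Subgroup (Equiv.Perm (Fin d))) :
    Subgroup (T ≃g T) :=
  Subgroup.closure
    {g | g ∈ universalGroup c F ∧ ∃ v w : V, T.Adj v w ∧ g v = v ∧ g w = w}

/-- The topology on `Aut(T)`: pointwise convergence on the discrete set of vertices.
Subgroups of `Aut(T)` carry the subspace topology. -/
instance autTopology (T : SimpleGraph V) : TopologicalSpace (T ≃g T) :=
  TopologicalSpace.induced (fun (g : T ≃g T) (v : V) => g v)
    (@Pi.topologicalSpace V (fun _ => V) (fun _ => ⊥))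

/-- A subgroup `H` of `G` is commensurated if its commensurator is all of `G`. -/
def IsCommensurated {G : Type*} [Group G] (H : Subgroup G) : Prop :=
  Subgroup.Commensurable.commensurator H = ⊤

end BurgerMozes

/-!
The argument works with the *half-trees* `branch T v w` and with their groups
`rigid c F (branch T v w)`: the elements of `U(F)` that fix everything outside the half-tree. These
groups lie in `U(F)⁺`. Elements supported in disjoint half-trees commute, and even infinitely many
of them can be multiplied (`exists_glue`); every half-tree contains infinitely many disjoint ones.

*Perfectness.* Since the point stabilizers of `F` are perfect, so are the groups of half-trees
(`rigid_branch_le_of_commutators`). Every element is, up to any given depth, a product of a bounded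
number of commutators, and compactness removes the depth. Hence a subgroup that contains all
commutators in the group of a half-tree contains that whole group.

*Capturing a half-tree.* Let `H` be commensurated. For `a ∈ U(F)⁺` and an infinite sequence in `H`,
pigeonhole yields infinitely many quotients `k ∈ H` with `⁅a, k⁆ ∈ H`. Unless `H` is finite, it
contains the group of some half-tree:
* If `H` has an infinite orbit, some half-tree has infinitely many disjoint translates under `H`
  (`exists_disjoint_translates`), and `⁅⁅a, k⁆, ⁅b, l⁆⁆ = ⁅a, b⁆` for `a`, `b` supported in it and
  suitable quotients `k`, `l` (`commutator_mem_of_disjoint_translates`).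
* If `H` meets the group of every half-tree nontrivially, a diagonal argument over infinitely many
  disjoint half-trees leads to the same double commutators
  (`exists_commutator_mem_of_nontrivial`).
* If all orbits of `H` are finite and `H` meets the group of some half-tree trivially, then `H` is
  finite (`finite_of_inter_rigid_trivial`). Otherwise it would contain a sequence of elements whose
  first moved vertices hang in disjoint half-trees of increasing depth, and an infinite product over
  these half-trees would commute with no quotient of two of them. This contradicts pigeonhole,
  because `H` meets the groups of all half-trees in finite groups.

*Spreading.* If `H` contains the group of one half-tree, it contains the groups of all half-trees
pointing away from a vertex `v` and sufficiently far from it (`exists_depth`). So `H` contains the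
pointwise stabilizer of a ball, and is open. If the orbits of `H` are finite, it is also compact. If
some orbit is infinite, `H` contains the pointwise stabilizers of three consecutive edges, generating
`U(F)⁺` (`plus_le_of_infinite_orbit`).
-/

namespace BurgerMozes

/-! ### Half-trees -/

section

variable {V : Type*} {T : SimpleGraph V}

/-- The half-tree hanging at `w` away from its neighbour `v`: the vertices closer to `w`
than to `v`. -/
def branch (T : SimpleGraph V) (v w : V) : Set V := {x | T.dist x w < T.dist x v}

theorem mem_branch {v w x : V} : x ∈ branch T v w ↔ T.dist x w < T.dist x v := Iff.rfl

theorem dist_map (g : T ≃g T) (x y : V) : T.dist (g x) (g y) = T.dist x y := by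
  have key : ∀ (g : T ≃g T) (x y : V), T.Reachable x y → T.dist (g x) (g y) ≤ T.dist x y := by
    intro g x y h
    obtain ⟨p, hp⟩ := h.exists_walk_length_eq_dist
    rw [← hp, ← SimpleGraph.Walk.length_map g.toHom p]
    exact SimpleGraph.dist_le _
  by_cases h : T.Reachable x y
  · refine le_antisymm (key g x y h) ?_
    have h' : T.Reachable (g x) (g y) := h.map g.toHom
    simpa using key g.symm _ _ h'
  · have h' : ¬ T.Reachable (g x) (g y) := fun h' => h (by simpa using h'.map g.symm.toHom)
    rw [SimpleGraph.dist_eq_zero_of_not_reachable h, SimpleGraph.dist_eq_zero_of_not_reachable h']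

theorem map_mem_branch_iff (g : T ≃g T) {v w x : V} :
    g x ∈ branch T (g v) (g w) ↔ x ∈ branch T v w := by
  simp only [mem_branch, dist_map]

theorem mem_branch_map_iff (g : T ≃g T) {v w x : V} :
    x ∈ branch T (g v) (g w) ↔ g⁻¹ x ∈ branch T v w := by
  rw [← map_mem_branch_iff g (x := g⁻¹ x), RelIso.apply_inv_self]

theorem adj_map (g : T ≃g T) {v w : V} (h : T.Adj v w) : T.Adj (g v) (g w) := g.map_rel_iff.2 h

theorem not_mem_branch_left {v w : V} : v ∉ branch T v w := by
  simp [mem_branch]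

theorem mem_branch_right {v w : V} (h : T.Adj v w) : w ∈ branch T v w := by
  simp [mem_branch, SimpleGraph.dist_eq_one_iff_adj.2 h.symm]

/-- If `p` is the neighbour of `y` towards `v`, then `v` is outside the half-tree at `y`
away from `p`. -/
theorem not_mem_branch_of_parent {v p y : V} (hd : T.dist v y = T.dist v p + 1) :
    v ∉ branch T p y := by
  rw [mem_branch]; omega

section Tree

variable (hT : T.IsTree)
include hT

theorem mem_branch_symm_iff {v w : V} (h : T.Adj v w) {x : V} :
    x ∈ branch T w v ↔ x ∉ branch T v w := by
  have := hT.dist_ne_of_adj x h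
  simp only [mem_branch]
  omega

theorem dist_of_mem_branch {v w : V} (h : T.Adj v w) {x : V} (hx : x ∈ branch T v w) :
    T.dist x v = T.dist x w + 1 := by
  have := hT.dist_eq_dist_add_one_of_adj x h
  rw [mem_branch] at hx
  omega

theorem dist_of_not_mem_branch {v w : V} (h : T.Adj v w) {x : V} (hx : x ∉ branch T v w) :
    T.dist x w = T.dist x v + 1 :=
  dist_of_mem_branch hT h.symm ((mem_branch_symm_iff hT h).2 hx)

theorem exists_parent {v x : V} (h : x ≠ v) : ∃ y, T.Adj x y ∧ T.dist v x = T.dist v y + 1 := by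
  obtain ⟨p, hp⟩ := hT.connected.exists_walk_length_eq_dist x v
  cases p with
  | nil => exact absurd rfl h
  | cons hadj q =>
    refine ⟨_, hadj, ?_⟩
    have h1 := SimpleGraph.dist_le q
    have h2 := hT.dist_eq_dist_add_one_of_adj v hadj
    rw [SimpleGraph.Walk.length_cons] at hp
    have c := fun a b : V => SimpleGraph.dist_comm (G := T) (u := a) (v := b)
    rw [c x] at hp
    rw [c _ v] at h1
    omega

theorem parent_unique {v x y y' : V} (hy : T.Adj x y) (hy' : T.Adj x y')
    (h : T.dist v y < T.dist v x) (h' : T.dist v y' < T.dist v x) : y = y' := by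
  classical
  obtain ⟨p, hp, -⟩ := hT.connected.exists_path_of_dist v x
  have key : ∀ z, T.Adj x z → T.dist v z < T.dist v x → z = p.penultimate := by
    intro z hz hlt
    obtain ⟨q, hq, hql⟩ := hT.connected.exists_path_of_dist v z
    refine hT.isAcyclic.eq_penultimate_of_adj_end hp hz ?_
    have : (q.concat hz.symm).IsPath := by
      refine hq.concat ?_ hz.symm
      intro hx
      have h1 := SimpleGraph.dist_le (q.takeUntil x hx)
      have h2 := q.length_takeUntil_le_length hx
      omega
    have hpq : p = q.concat hz.symm := congrArg Subtype.val
      ((hT.isAcyclic.subsingleton_path v x).elim ⟨p, hp⟩ ⟨q.concat hz.symm, this⟩)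
    rw [hpq]
    simp [SimpleGraph.Walk.support_concat]
  rw [key y hy h, key y' hy' h']

/-- The only edge leaving a half-tree is the one that defines it. -/
theorem eq_of_adj_of_mem_branch {v w : V} (h : T.Adj v w) {x y : V} (hxy : T.Adj x y)
    (hx : x ∈ branch T v w) (hy : y ∉ branch T v w) : x = w ∧ y = v := by
  have h1 := dist_of_mem_branch hT h hx
  have h2 := dist_of_not_mem_branch hT h hy
  have h3 := hT.dist_eq_dist_add_one_of_adj v hxy
  have h4 := hT.dist_eq_dist_add_one_of_adj w hxy
  have c := fun a b : V => SimpleGraph.dist_comm (G := T) (u := a) (v := b)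
  rw [c x, c x] at h1
  rw [c y, c y] at h2
  have hwx : x = w := by
    by_contra hne
    obtain ⟨z, hz, hzd⟩ := exists_parent hT hne
    have h5 := hT.dist_eq_dist_add_one_of_adj v hz
    have h6 := hT.dist_eq_dist_add_one_of_adj z h
    rw [c z, c z] at h6
    have : z = y := parent_unique hT (v := v) hz hxy (by omega) (by omega)
    subst this
    omega
  subst hwx
  refine ⟨rfl, ?_⟩
  have : T.dist v y = 0 := by
    have := SimpleGraph.dist_self (G := T) (v := x)
    omega
  exact ((hT.connected.dist_eq_zero_iff).1 this).symm

theorem dist_of_mem_of_not_mem {v w : V} (h : T.Adj v w) {x y : V}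
    (hx : x ∈ branch T v w) (hy : y ∉ branch T v w) :
    T.dist x y = T.dist x w + 1 + T.dist v y := by
  classical
  obtain ⟨p, hp⟩ := hT.connected.exists_walk_length_eq_dist x y
  obtain ⟨e, he, he1, he2⟩ := p.exists_boundary_dart _ hx hy
  obtain ⟨-, h2⟩ := eq_of_adj_of_mem_branch hT h e.adj he1 he2
  have hv : v ∈ p.support := h2 ▸ p.dart_snd_mem_support_of_mem_darts he
  have h3 := congrArg SimpleGraph.Walk.length (p.take_spec hv)
  rw [SimpleGraph.Walk.length_append] at h3
  have h4 := SimpleGraph.dist_le (p.takeUntil v hv)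
  have h5 := SimpleGraph.dist_le (p.dropUntil v hv)
  have h6 := hT.connected.dist_triangle (u := x) (v := v) (w := y)
  have h7 := dist_of_mem_branch hT h hx
  omega

theorem branch_disjoint {v w v' w' : V} (h : T.Adj v w) (h' : T.Adj v' w')
    (hv : v ∉ branch T v' w') (hv' : v' ∉ branch T v w) (hne : v ≠ v' ∨ w ≠ w') :
    Disjoint (branch T v w) (branch T v' w') := by
  rw [Set.disjoint_left]
  intro x hx hx'
  have h1 := dist_of_mem_of_not_mem hT h hx hv'
  have h2 := dist_of_mem_of_not_mem hT h' hx' hv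
  have h3 := dist_of_mem_branch hT h hx
  have h4 := dist_of_mem_branch hT h' hx'
  have h5 : T.dist v v' = 0 := by
    rw [SimpleGraph.dist_comm (u := v')] at h2
    omega
  obtain rfl := (hT.connected.dist_eq_zero_iff).1 h5
  have c := fun a b : V => SimpleGraph.dist_comm (G := T) (u := a) (v := b)
  rw [c x, c x] at h3 h4
  by_cases hxv : x = v
  · subst hxv; exact hv hx'
  · have e1 : ∀ u, T.Adj v u → T.dist v x = T.dist u x + 1 → T.dist x u < T.dist x v := by
      intro u _ hu
      rw [c x, c x]
      omega
    have := parent_unique hT h h' (e1 _ h h3) (e1 _ h' h4)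
    rcases hne with hne | hne
    · exact hne rfl
    · exact hne this

theorem branch_subset {v w v' w' : V} (h : T.Adj v w) (h' : T.Adj v' w')
    (hv : v ∉ branch T v' w') (hv' : v' ∈ branch T v w) :
    branch T v' w' ⊆ branch T v w := by
  intro x hx
  by_contra hxn
  have h1 := dist_of_mem_of_not_mem hT h hv' hxn
  have h2 := dist_of_mem_of_not_mem hT h' hx hv
  have h3 := dist_of_mem_branch hT h' hx
  have h4 := dist_of_mem_branch hT h hv'
  have c := fun a b : V => SimpleGraph.dist_comm (G := T) (u := a) (v := b)
  rw [c x w', c v' v] at h2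
  rw [c x w', c x v'] at h3
  rw [c x v] at h2
  omega

/-- Distinct half-trees at the same vertex are disjoint. -/
theorem branch_disjoint_of_ne {v w w' : V} (h : T.Adj v w) (h' : T.Adj v w') (hne : w ≠ w') :
    Disjoint (branch T v w) (branch T v w') :=
  branch_disjoint hT h h' not_mem_branch_left not_mem_branch_left (Or.inr hne)

/-- Child half-trees are contained in their parent. -/
theorem branch_child_subset {v w u : V} (h : T.Adj v w) (h' : T.Adj w u) (hne : u ≠ v) :
    branch T w u ⊆ branch T v w := by
  refine branch_subset hT h h' ?_ (mem_branch_right h)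
  intro hv
  have h1 := dist_of_mem_branch hT h' hv
  rw [SimpleGraph.dist_eq_one_iff_adj.2 h] at h1
  exact hne ((hT.connected.dist_eq_zero_iff).1 (by omega : T.dist v u = 0)).symm

theorem exists_mem_branch {v x : V} (h : x ≠ v) : ∃ w, T.Adj v w ∧ x ∈ branch T v w := by
  obtain ⟨w, hw, hd⟩ := exists_parent hT h.symm
  exact ⟨w, hw, by rw [mem_branch]; omega⟩

/-- A vertex of a half-tree other than its root lies in a child half-tree. -/
theorem exists_child_of_mem_branch {v w x : V} (h : T.Adj v w) (hx : x ∈ branch T v w)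
    (hne : x ≠ w) : ∃ u, T.Adj w u ∧ u ≠ v ∧ x ∈ branch T w u := by
  obtain ⟨u, hu, hxu⟩ := exists_mem_branch hT hne
  refine ⟨u, hu, ?_, hxu⟩
  rintro rfl
  exact (mem_branch_symm_iff hT h).1 hxu hx

/-- Two half-trees are nested, disjoint, or cover the tree. -/
theorem branch_trichotomy {v w v' w' : V} (h : T.Adj v w) (h' : T.Adj v' w') :
    Disjoint (branch T v w) (branch T v' w') ∨ branch T v' w' ⊆ branch T v w ∨
      branch T v w ⊆ branch T v' w' ∨ ∀ x, x ∈ branch T v w ∨ x ∈ branch T v' w' := by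
  by_cases hv : v ∈ branch T v' w' <;> by_cases hv' : v' ∈ branch T v w
  · refine Or.inr (Or.inr (Or.inr fun x => ?_))
    by_contra hx
    push Not at hx
    have h1 := dist_of_mem_of_not_mem hT h hv' hx.1
    have h2 := dist_of_mem_of_not_mem hT h' hv hx.2
    omega
  · exact Or.inr (Or.inr (Or.inl (branch_subset hT h' h hv' hv)))
  · exact Or.inr (Or.inl (branch_subset hT h h' hv hv'))
  · by_cases hne : v = v' ∧ w = w'
    · obtain ⟨rfl, rfl⟩ := hne
      exact Or.inr (Or.inl subset_rfl)
    · exact Or.inl (branch_disjoint hT h h' hv hv' (by tauto))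

theorem dist_lt_of_mem_branch {v p y x : V} (h : T.Adj p y) (hd : T.dist v y = T.dist v p + 1)
    (hx : x ∈ branch T p y) (hne : x ≠ y) : T.dist v y < T.dist v x := by
  have h1 := dist_of_mem_of_not_mem hT h hx (not_mem_branch_of_parent hd)
  have h2 : 0 < T.dist x y := hT.connected.pos_dist_of_ne hne
  rw [SimpleGraph.dist_comm (u := v) (v := x), h1, hd, SimpleGraph.dist_comm (u := v)]
  omega

theorem dist_le_of_mem_branch {v p y x : V} (h : T.Adj p y) (hd : T.dist v y = T.dist v p + 1)
    (hx : x ∈ branch T p y) : T.dist v y ≤ T.dist v x := by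
  by_cases hne : x = y
  · rw [hne]
  · exact (dist_lt_of_mem_branch hT h hd hx hne).le

/-- A vertex at distance at least `n ≥ 1` from `v` lies in a half-tree away from `v` whose root is
at distance exactly `n` from `v`. -/
theorem exists_ancestor {v x : V} {n : ℕ} (hn : 1 ≤ n) (hx : n ≤ T.dist v x) :
    ∃ p y, T.Adj p y ∧ T.dist v y = n ∧ T.dist v p + 1 = n ∧ x ∈ branch T p y := by
  induction hk : T.dist v x - n generalizing x with
  | zero =>
    have hxv : x ≠ v := by rintro rfl; simp at hx; omega
    obtain ⟨p, hp, hd⟩ := exists_parent hT hxv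
    exact ⟨p, x, hp.symm, by omega, by omega, mem_branch_right hp.symm⟩
  | succ k ih =>
    have hxv : x ≠ v := by rintro rfl; simp at hx; omega
    obtain ⟨q, hq, hd⟩ := exists_parent hT hxv
    obtain ⟨p, y, hpy, h1, h2, h3⟩ := ih (x := q) (by omega) (by omega)
    refine ⟨p, y, hpy, h1, h2, ?_⟩
    by_contra hxn
    obtain ⟨rfl, rfl⟩ := eq_of_adj_of_mem_branch hT hpy hq.symm h3 hxn
    omega

end Tree

end

/-! ### Colorings, local permutations and rigid stabilizers -/

section

variable {V : Type*} {T : SimpleGraph V} {d : ℕ} (c : Coloring T d)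

/-- The color of the edge between two adjacent vertices. -/
def Coloring.col {v w : V} (h : T.Adj v w) : Fin d := c.color ⟨s(v, w), h⟩

theorem col_symm {v w : V} (h : T.Adj v w) : c.col h.symm = c.col h :=
  congrArg c.color (Subtype.ext Sym2.eq_swap)

/-- The neighbour of `v` across the edge of color `i`. -/
noncomputable def Coloring.nb (v : V) (i : Fin d) : V :=
  Sym2.Mem.other ((c.colorAt v).symm i).2

theorem nb_spec (v : V) (i : Fin d) : s(v, c.nb v i) = (((c.colorAt v).symm i).1 : Sym2 V) :=
  Sym2.other_spec _

theorem adj_nb (v : V) (i : Fin d) : T.Adj v (c.nb v i) := by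
  have := ((c.colorAt v).symm i).1.2
  rwa [← nb_spec] at this

theorem col_nb (v : V) (i : Fin d) : c.col (adj_nb c v i) = i := by
  have h : (⟨s(v, c.nb v i), adj_nb c v i⟩ : T.edgeSet) = ((c.colorAt v).symm i).1 :=
    Subtype.ext (nb_spec c v i)
  rw [Coloring.col, h]
  exact (c.colorAt v).apply_symm_apply i

/-- The edge between adjacent vertices, as an element of `E(v)`. -/
def edgeAt {v w : V} (h : T.Adj v w) : EdgesAt T v := ⟨⟨s(v, w), h⟩, Sym2.mem_mk_left v w⟩

theorem colorAt_edgeAt {v w : V} (h : T.Adj v w) : c.colorAt v (edgeAt h) = c.col h := rfl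

theorem col_injective {v w w' : V} (h : T.Adj v w) (h' : T.Adj v w')
    (e : c.col h = c.col h') : w = w' := by
  have h1 : edgeAt h = edgeAt h' := (c.colorAt v).injective e
  have h2 : s(v, w) = s(v, w') := congrArg (fun e : EdgesAt T v => (e.1 : Sym2 V)) h1
  exact Sym2.congr_right.1 h2

theorem nb_col {v w : V} (h : T.Adj v w) : c.nb v (c.col h) = w :=
  col_injective c (adj_nb c v _) h (col_nb c v _)

theorem nb_injective (v : V) : Function.Injective (c.nb v) := by
  intro i j h
  rw [← col_nb c v i, ← col_nb c v j]
  congr 1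

theorem nb_nb (v : V) (i : Fin d) : c.nb (c.nb v i) i = v := by
  have h := nb_col c (adj_nb c v i).symm
  rwa [col_symm c (adj_nb c v i), col_nb] at h

theorem localPerm_col (g : T ≃g T) {v w : V} (h : T.Adj v w) :
    localPerm c g v (c.col h) = c.col (adj_map g h) := by
  rw [← colorAt_edgeAt, localPerm_colorAt, ← colorAt_edgeAt]
  rfl

theorem map_nb (g : T ≃g T) (v : V) (i : Fin d) :
    g (c.nb v i) = c.nb (g v) (localPerm c g v i) := by
  conv_rhs => rw [← col_nb c v i, localPerm_col, nb_col]

/-- The local permutation only depends on the action on the star of the vertex. -/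
theorem localPerm_congr {g u : T ≃g T} {v : V} (h : g v = u v)
    (h' : ∀ w, T.Adj v w → g w = u w) : localPerm c g v = localPerm c u v := by
  ext i
  have h1 := map_nb c g v i
  rw [h' _ (adj_nb c v i), map_nb, ← h] at h1
  rw [nb_injective c _ h1]

theorem localPerm_eq_of_map_nb {g : T ≃g T} {v : V} {σ : Equiv.Perm (Fin d)}
    (h : ∀ i, g (c.nb v i) = c.nb (g v) (σ i)) : localPerm c g v = σ := by
  ext i
  rw [nb_injective c _ ((map_nb c g v i).symm.trans (h i))]

/-- A bijection that agrees with elements of `U(F)` on the star of every vertex is in `U(F)`. -/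
theorem exists_of_locally {F : Subgroup (Equiv.Perm (Fin d))} {f : V → V}
    (hf : Function.Bijective f)
    (h : ∀ x, ∃ u ∈ universalGroup c F, f x = u x ∧ ∀ y, T.Adj x y → f y = u y) :
    ∃ g ∈ universalGroup c F, ∀ x, g x = f x := by
  have hadj : ∀ {x y : V}, T.Adj (f x) (f y) ↔ T.Adj x y := by
    intro x y
    obtain ⟨u, -, hu, hu'⟩ := h x
    constructor
    · intro hxy
      have h1 : T.Adj x (u⁻¹ (f y)) := by
        have := adj_map u⁻¹ hxy
        rwa [hu, RelIso.inv_apply_self] at this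
      have h2 := hu' _ h1
      rw [RelIso.apply_inv_self] at h2
      rwa [hf.1 h2] at h1
    · intro hxy
      rw [hu, hu' y hxy]
      exact adj_map u hxy
  refine ⟨⟨Equiv.ofBijective f hf, hadj⟩, fun x => ?_, fun x => rfl⟩
  obtain ⟨u, hu, h1, h2⟩ := h x
  rw [localPerm_congr c (u := u) h1 h2]
  exact hu x

section Tree

variable (hT : T.IsTree)
include hT

theorem induction_on_nb {P : V → Prop} (v : V) (hv : P v) (h : ∀ x i, P x → P (c.nb x i)) :
    ∀ x, P x := by
  intro x
  induction hn : T.dist v x generalizing x with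
  | zero => rwa [← (hT.connected.dist_eq_zero_iff).1 hn]
  | succ n ih =>
    have hne : x ≠ v := by rintro rfl; simp at hn
    obtain ⟨y, hy, hd⟩ := exists_parent hT hne
    rw [← nb_col c hy.symm]
    exact h _ _ (ih y (by omega))

theorem exists_nb_equivariant (v v' : V) (σ : Equiv.Perm (Fin d)) :
    ∃ f : V → V, f v = v' ∧ ∀ x i, f (c.nb x i) = c.nb (f x) (σ i) := by
  classical
  choose p hp hd using fun x : {x // x ≠ v} => exists_parent hT x.2
  have key : ∃ f : V → V, ∀ x, f x = if h : x = v then v' else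
      c.nb (f (p ⟨x, h⟩)) (σ (c.col (hp ⟨x, h⟩))) := by
    have wf : WellFounded fun x y : V => T.dist v x < T.dist v y :=
      (measure fun x => T.dist v x).wf
    let step : ∀ x, (∀ y, T.dist v y < T.dist v x → V) → V := fun x ih =>
      if h : x = v then v' else
        c.nb (ih (p ⟨x, h⟩) (by have := hd ⟨x, h⟩; dsimp only at this; omega))
          (σ (c.col (hp ⟨x, h⟩)))
    exact ⟨wf.fix step, fun x => wf.fix_eq step x⟩
  obtain ⟨f, hf⟩ := key
  refine ⟨f, by rw [hf, dif_pos rfl], fun x i => ?_⟩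
  have hadj := adj_nb c x i
  have hcol : ∀ (a b : V) (h : T.Adj a b) (h' : T.Adj (c.nb x i) x), a = c.nb x i → b = x →
      c.col h = i := by
    rintro a b h h' rfl rfl
    rw [← col_symm, col_nb]
  rcases hT.dist_eq_dist_add_one_of_adj v hadj with h | h
  · -- the parent of `x` is `nb x i`
    have hx : x ≠ v := by rintro rfl; simp at h
    have hpx : p ⟨x, hx⟩ = c.nb x i :=
      parent_unique hT (v := v) (hp ⟨x, hx⟩) hadj
        (by have := hd ⟨x, hx⟩; dsimp only at this ⊢; omega)
        (by dsimp only; omega)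
    have hc : c.col (hp ⟨x, hx⟩) = i := by
      rw [← col_nb c x i]; congr 1
    have h1 := hf x
    rw [dif_neg hx, hc, hpx] at h1
    rw [h1, nb_nb]
  · -- `x` is the parent of `nb x i`
    have hx : c.nb x i ≠ v := by intro e; rw [e] at h; simp at h
    have hpx : p ⟨_, hx⟩ = x :=
      parent_unique hT (v := v) (hp ⟨_, hx⟩) hadj.symm
        (by have := hd ⟨_, hx⟩; dsimp only at this ⊢; omega) (by dsimp only; omega)
    rw [hf (c.nb x i), dif_neg hx, hcol _ _ (hp ⟨_, hx⟩) hadj.symm rfl hpx, hpx]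

/-- For every permutation `σ` of the colors there is an automorphism with constant local
permutation `σ` mapping `v` to `v'`. -/
theorem exists_constant_localPerm (v v' : V) (σ : Equiv.Perm (Fin d)) :
    ∃ g : T ≃g T, g v = v' ∧ ∀ x, localPerm c g x = σ := by
  obtain ⟨f, hfv, hf⟩ := exists_nb_equivariant c hT v v' σ
  obtain ⟨f', hfv', hf'⟩ := exists_nb_equivariant c hT v' v σ⁻¹
  have h1 : ∀ x, f' (f x) = x :=
    induction_on_nb c hT v (by rw [hfv, hfv']) fun x i hx => by
      simp [hf, hf', hx]
  have h2 : ∀ x, f (f' x) = x :=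
    induction_on_nb c hT v' (by rw [hfv', hfv]) fun x i hx => by
      simp [hf, hf', hx]
  have hom : ∀ (f : V → V) (σ : Equiv.Perm (Fin d)), (∀ x i, f (c.nb x i) = c.nb (f x) (σ i)) →
      ∀ x y, T.Adj x y → T.Adj (f x) (f y) := by
    intro f σ hf x y h
    rw [← nb_col c h, hf]
    exact adj_nb c _ _
  refine ⟨⟨⟨f, f', h1, h2⟩, ?_⟩, hfv, fun x => localPerm_eq_of_map_nb c fun i => hf x i⟩
  intro x y
  refine ⟨fun h => ?_, hom f σ hf x y⟩
  have := hom f' σ⁻¹ hf' _ _ h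
  simpa [h1] using this

end Tree

/-- The elements of `U(F)` that fix every vertex outside `S`. -/
noncomputable def rigid (F : Subgroup (Equiv.Perm (Fin d))) (S : Set V) : Subgroup (T ≃g T) where
  carrier := {g | g ∈ universalGroup c F ∧ ∀ x ∉ S, g x = x}
  one_mem' := ⟨one_mem _, fun _ _ => rfl⟩
  mul_mem' := fun {g h} hg hh => ⟨mul_mem hg.1 hh.1, fun x hx => by
    rw [RelIso.mul_apply, hh.2 x hx, hg.2 x hx]⟩
  inv_mem' := fun {g} hg => ⟨inv_mem hg.1, fun x hx => by
    conv_lhs => rw [← hg.2 x hx]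
    exact RelIso.inv_apply_self g x⟩

variable {F : Subgroup (Equiv.Perm (Fin d))}

theorem mem_rigid {S : Set V} {g : T ≃g T} :
    g ∈ rigid c F S ↔ g ∈ universalGroup c F ∧ ∀ x ∉ S, g x = x := Iff.rfl

theorem rigid_mono {S S' : Set V} (h : S ⊆ S') : rigid c F S ≤ rigid c F S' :=
  fun _ hg => ⟨hg.1, fun x hx => hg.2 x fun hxS => hx (h hxS)⟩

theorem map_mem_of_mem_rigid {S : Set V} {g : T ≃g T} (hg : g ∈ rigid c F S) {x : V}
    (hx : x ∈ S) : g x ∈ S := by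
  by_contra h
  have := hg.2 _ h
  exact h ((g.injective this).symm ▸ hx)

theorem commute_of_disjoint {S S' : Set V} (h : Disjoint S S') {g g' : T ≃g T}
    (hg : g ∈ rigid c F S) (hg' : g' ∈ rigid c F S') : Commute g g' := by
  rw [Set.disjoint_left] at h
  refine RelIso.ext fun x => ?_
  rw [RelIso.mul_apply, RelIso.mul_apply]
  by_cases hx : x ∈ S
  · rw [hg'.2 x (h hx), hg'.2 _ (h (map_mem_of_mem_rigid c hg hx))]
  · rw [hg.2 x hx]
    by_cases hx' : x ∈ S'
    · exact hg.2 _ fun h' => h h' (map_mem_of_mem_rigid c hg' hx')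
    · rw [hg'.2 x hx', hg.2 x hx]

theorem conj_mem_rigid {k g : T ≃g T} (hk : k ∈ universalGroup c F) {S : Set V}
    (hg : g ∈ rigid c F S) : k * g * k⁻¹ ∈ rigid c F (k '' S) := by
  refine ⟨mul_mem (mul_mem hk hg.1) (inv_mem hk), fun x hx => ?_⟩
  have : k⁻¹ x ∉ S := fun h => hx ⟨_, h, RelIso.apply_inv_self k x⟩
  rw [RelIso.mul_apply, RelIso.mul_apply, hg.2 _ this, RelIso.apply_inv_self]

theorem image_branch (g : T ≃g T) (v w : V) : g '' branch T v w = branch T (g v) (g w) := by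
  ext x
  rw [mem_branch_map_iff]
  constructor
  · rintro ⟨y, hy, rfl⟩; simpa using hy
  · intro h; exact ⟨_, h, RelIso.apply_inv_self g x⟩

theorem conj_mem_rigid_branch {k g : T ≃g T} (hk : k ∈ universalGroup c F) {v w : V}
    (hg : g ∈ rigid c F (branch T v w)) : k * g * k⁻¹ ∈ rigid c F (branch T (k v) (k w)) := by
  rw [← image_branch]; exact conj_mem_rigid c hk hg

theorem fixes_left {v w : V} {g : T ≃g T} (hg : g ∈ rigid c F (branch T v w)) : g v = v :=
  hg.2 v not_mem_branch_left

section Tree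

variable (hT : T.IsTree)
include hT

theorem fixes_right {v w : V} (h : T.Adj v w) {g : T ≃g T}
    (hg : g ∈ rigid c F (branch T v w)) : g w = w := by
  have h1 : g w ∈ branch T v w := map_mem_of_mem_rigid c hg (mem_branch_right h)
  have h2 := adj_map g h
  rw [fixes_left c hg] at h2
  exact (eq_of_adj_of_mem_branch hT h h2.symm h1 not_mem_branch_left).1

theorem rigid_le_plus {v w : V} (h : T.Adj v w) :
    rigid c F (branch T v w) ≤ universalGroupPlus c F :=
  fun _ hg => Subgroup.subset_closure
    ⟨hg.1, v, w, h, fixes_left c hg, fixes_right c hT h hg⟩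

/-- Restriction of an edge-fixing element to a half-tree. -/
theorem exists_restrict {v w : V} (h : T.Adj v w) {g : T ≃g T} (hg : g ∈ universalGroup c F)
    (hv : g v = v) (hw : g w = w) :
    ∃ r ∈ rigid c F (branch T v w), ∀ x ∈ branch T v w, r x = g x := by
  classical
  have hmem : ∀ {x}, g x ∈ branch T v w ↔ x ∈ branch T v w := by
    intro x
    conv_lhs => rw [← hv, ← hw]
    rw [hv, hw]
    have := map_mem_branch_iff g (v := v) (w := w) (x := x)
    rwa [hv, hw] at this
  have hmem' : ∀ {x}, g⁻¹ x ∈ branch T v w ↔ x ∈ branch T v w := by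
    intro x
    rw [← hmem, RelIso.apply_inv_self]
  let f : V → V := fun x => if x ∈ branch T v w then g x else x
  have hf1 : ∀ x ∈ branch T v w, f x = g x := fun x hx => if_pos hx
  have hf2 : ∀ x ∉ branch T v w, f x = x := fun x hx => if_neg hx
  have hbij : Function.Bijective f := by
    refine Function.bijective_iff_has_inverse.2
      ⟨fun x => if x ∈ branch T v w then g⁻¹ x else x, fun x => ?_, fun x => ?_⟩
    · by_cases hx : x ∈ branch T v w
      · simp only [hf1 x hx, if_pos (hmem.2 hx), RelIso.inv_apply_self]
      · simp only [hf2 x hx, if_neg hx]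
    · by_cases hx : x ∈ branch T v w
      · simp only [if_pos hx, hf1 _ (hmem'.2 hx), RelIso.apply_inv_self]
      · simp only [if_neg hx, hf2 x hx]
  obtain ⟨r, hr, hrf⟩ := exists_of_locally c (F := F) hbij fun x => by
    by_cases hx : x ∈ branch T v w
    · refine ⟨g, hg, hf1 x hx, fun y hy => ?_⟩
      by_cases hyb : y ∈ branch T v w
      · exact hf1 y hyb
      · rw [hf2 y hyb, (eq_of_adj_of_mem_branch hT h hy hx hyb).2, hv]
    · refine ⟨1, one_mem _, hf2 x hx, fun y hy => ?_⟩
      by_cases hyb : y ∈ branch T v w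
      · rw [hf1 y hyb, (eq_of_adj_of_mem_branch hT h hy.symm hyb hx).1, hw]; rfl
      · exact hf2 y hyb
  exact ⟨r, ⟨hr, fun x hx => (hrf x).trans (hf2 x hx)⟩, fun x hx => (hrf x).trans (hf1 x hx)⟩

/-- Independence property: elements supported in pairwise disjoint half-trees have a common
product, even if there are infinitely many of them. -/
theorem exists_glue {ι : Type*} (p y : ι → V) (hadj : ∀ k, T.Adj (p k) (y k))
    (hdis : Pairwise fun k l => Disjoint (branch T (p k) (y k)) (branch T (p l) (y l)))
    (a : ι → T ≃g T) (ha : ∀ k, a k ∈ rigid c F (branch T (p k) (y k))) :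
    ∃ g ∈ rigid c F (⋃ k, branch T (p k) (y k)),
      ∀ k, ∀ x ∈ branch T (p k) (y k), g x = a k x := by
  classical
  have huniq : ∀ {k l x}, x ∈ branch T (p k) (y k) → x ∈ branch T (p l) (y l) → k = l := by
    intro k l x hk hl
    by_contra hne
    exact Set.disjoint_left.1 (hdis hne) hk hl
  have key : ∀ a : ι → T ≃g T, ∃ f : V → V, (∀ k, ∀ x ∈ branch T (p k) (y k), f x = a k x) ∧
      ∀ x, (∀ k, x ∉ branch T (p k) (y k)) → f x = x := by
    intro a
    refine ⟨fun x => if hx : ∃ k, x ∈ branch T (p k) (y k) then a hx.choose x else x, ?_, ?_⟩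
    · intro k x hx
      have hex : ∃ k, x ∈ branch T (p k) (y k) := ⟨k, hx⟩
      simp only [dif_pos hex]
      rw [huniq hex.choose_spec hx]
    · intro x hx
      exact dif_neg (by simpa using hx)
  obtain ⟨f, hf1, hf2⟩ := key a
  obtain ⟨f', hf1', hf2'⟩ := key fun k => (a k)⁻¹
  have hbij : Function.Bijective f := by
    refine Function.bijective_iff_has_inverse.2 ⟨f', fun x => ?_, fun x => ?_⟩
    · by_cases hx : ∃ k, x ∈ branch T (p k) (y k)
      · obtain ⟨k, hk⟩ := hx
        rw [hf1 k x hk, hf1' k _ (map_mem_of_mem_rigid c (ha k) hk), RelIso.inv_apply_self]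
      · push Not at hx
        rw [hf2 x hx, hf2' x hx]
    · by_cases hx : ∃ k, x ∈ branch T (p k) (y k)
      · obtain ⟨k, hk⟩ := hx
        rw [hf1' k x hk, hf1 k _ (map_mem_of_mem_rigid c (inv_mem (ha k)) hk),
          RelIso.apply_inv_self]
      · push Not at hx
        rw [hf2' x hx, hf2 x hx]
  -- the root of a half-tree in the family is fixed
  have hroot : ∀ {k x z}, x ∉ branch T (p k) (y k) → T.Adj x z → z ∈ branch T (p k) (y k) →
      f z = z := by
    intro k x z hx hxz hz
    have := (eq_of_adj_of_mem_branch hT (hadj k) hxz.symm hz hx).1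
    rw [hf1 k z hz, this, fixes_right c hT (hadj k) (ha k)]
  obtain ⟨r, hr, hrf⟩ := exists_of_locally c (F := F) hbij fun x => by
    by_cases hx : ∃ k, x ∈ branch T (p k) (y k)
    · obtain ⟨k, hk⟩ := hx
      refine ⟨a k, (ha k).1, hf1 k x hk, fun z hz => ?_⟩
      by_cases hzk : z ∈ branch T (p k) (y k)
      · exact hf1 k z hzk
      · rw [(ha k).2 z hzk]
        by_cases hzl : ∃ l, z ∈ branch T (p l) (y l)
        · obtain ⟨l, hl⟩ := hzl
          refine hroot (fun hxl => ?_) hz hl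
          rw [huniq hk hxl] at hzk
          exact hzk hl
        · push Not at hzl
          exact hf2 z hzl
    · push Not at hx
      refine ⟨1, one_mem _, hf2 x hx, fun z hz => ?_⟩
      by_cases hzl : ∃ l, z ∈ branch T (p l) (y l)
      · obtain ⟨l, hl⟩ := hzl
        exact hroot (hx l) hz hl
      · push Not at hzl
        exact hf2 z hzl
  refine ⟨r, ⟨hr, fun x hx => ?_⟩, fun k x hx => (hrf x).trans (hf1 k x hx)⟩
  rw [hrf, hf2 x (by simpa using hx)]

end Tree

end

/-! ### Transitivity and generation of `U(F)⁺` -/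

section

variable {V : Type*} {T : SimpleGraph V} {d : ℕ} (c : Coloring T d)
  {F : Subgroup (Equiv.Perm (Fin d))}

theorem plus_le : universalGroupPlus c F ≤ universalGroup c F :=
  (Subgroup.closure_le _).2 fun _ hg => hg.1

theorem exists_adj_ne (c : Coloring T d) (hd : 3 ≤ d) (v a b : V) :
    ∃ u, T.Adj v u ∧ u ≠ a ∧ u ≠ b := by
  classical
  have h1 : (Finset.univ.image (c.nb v)).card = d := by
    rw [Finset.card_image_of_injective _ (nb_injective c v), Finset.card_fin]
  have h2 : ({a, b} : Finset V).card ≤ 2 := Finset.card_le_two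
  obtain ⟨u, hu, hu'⟩ := Finset.exists_mem_notMem_of_card_lt_card
    (show ({a, b} : Finset V).card < (Finset.univ.image (c.nb v)).card by omega)
  obtain ⟨i, -, rfl⟩ := Finset.mem_image.1 hu
  exact ⟨_, adj_nb c v i, by simp at hu'; tauto, by simp at hu'; tauto⟩

/-- Double transitivity of a permutation group on the colors. -/
def IsTwoTransitive (F : Subgroup (Equiv.Perm (Fin d))) : Prop :=
  ∀ i j k l : Fin d, i ≠ j → k ≠ l → ∃ σ ∈ F, σ i = k ∧ σ j = l

section Tree

variable (hT : T.IsTree)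
include hT

/-- A permutation in `F` fixing the color of the edge `{v, w}` is the local permutation at `w` of
an element supported in the half-tree at `w`. -/
theorem exists_rigid_localPerm {v w : V} (h : T.Adj v w) {σ : Equiv.Perm (Fin d)} (hσ : σ ∈ F)
    (hfix : σ (c.col h) = c.col h) :
    ∃ g ∈ rigid c F (branch T v w), localPerm c g w = σ := by
  obtain ⟨g, hgw, hg⟩ := exists_constant_localPerm c hT w w σ
  have hgU : g ∈ universalGroup c F := fun x => by rw [hg]; exact hσ
  have hgv : g v = v := by
    have := map_nb c g w (c.col h.symm)
    rwa [hg, hgw, col_symm c h, hfix, ← col_symm c h, nb_col] at this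
  obtain ⟨r, hr, hrg⟩ := exists_restrict c hT h hgU hgv hgw
  refine ⟨r, hr, ?_⟩
  rw [← hg w]
  refine localPerm_congr c (hrg _ (mem_branch_right h)) fun u hu => ?_
  by_cases hub : u ∈ branch T v w
  · exact hrg u hub
  · rw [(eq_of_adj_of_mem_branch hT h hu (mem_branch_right h) hub).2, hgv, fixes_left c hr]

theorem exists_rigid_map_adj (hF : IsTwoTransitive F) {q p y₁ y₂ : V} (hq : T.Adj q p)
    (h₁ : T.Adj p y₁) (h₂ : T.Adj p y₂) (hne₁ : y₁ ≠ q) (hne₂ : y₂ ≠ q) :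
    ∃ g ∈ rigid c F (branch T q p), g y₁ = y₂ := by
  obtain ⟨σ, hσ, h3, h4⟩ := hF (c.col hq) (c.col h₁) (c.col hq) (c.col h₂)
    (fun e => hne₁ (col_injective c h₁ hq.symm (by rw [← e, col_symm])))
    (fun e => hne₂ (col_injective c h₂ hq.symm (by rw [← e, col_symm])))
  obtain ⟨g, hg, hgσ⟩ := exists_rigid_localPerm c hT hq hσ h3
  refine ⟨g, hg, ?_⟩
  rw [← nb_col c h₁, map_nb, hgσ, h4, fixes_right c hT hq hg, nb_col]

/-- Vertex stabilizers of `U(F)` lie in `U(F)⁺` when `F` is generated by point stabilizers. -/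
theorem stabilizer_le_plus
    (hgen : ∀ K : Subgroup (Equiv.Perm (Fin d)), (∀ σ ∈ F, ∀ i, σ i = i → σ ∈ K) → F ≤ K)
    {g : T ≃g T} (hg : g ∈ universalGroup c F) {v : V} (hv : g v = v) (hd : 0 < d) :
    g ∈ universalGroupPlus c F := by
  -- the local permutations at `v` of elements of `U(F)⁺` fixing `v` form a subgroup
  let K : Subgroup (Equiv.Perm (Fin d)) :=
    { carrier := {σ | ∃ k ∈ universalGroupPlus c F, k v = v ∧ localPerm c k v = σ}
      one_mem' := ⟨1, one_mem _, rfl, localPerm_one c v⟩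
      mul_mem' := by
        rintro _ _ ⟨k, hk, hkv, rfl⟩ ⟨l, hl, hlv, rfl⟩
        exact ⟨k * l, mul_mem hk hl, by rw [RelIso.mul_apply, hlv, hkv],
          by rw [localPerm_mul, hlv]⟩
      inv_mem' := by
        rintro _ ⟨k, hk, hkv, rfl⟩
        have hkv' : k⁻¹ v = v := by
          conv_lhs => rw [← hkv]
          exact RelIso.inv_apply_self k v
        refine ⟨k⁻¹, inv_mem hk, hkv', ?_⟩
        have h1 := localPerm_mul c k k⁻¹ v
        rw [mul_inv_cancel, localPerm_one, hkv'] at h1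
        exact eq_inv_of_mul_eq_one_right h1.symm }
  have hK : F ≤ K := hgen K fun σ hσ i hi => by
    obtain ⟨k, hkv, hk⟩ := exists_constant_localPerm c hT v v σ
    have hki : k (c.nb v i) = c.nb v i := by rw [map_nb, hk, hkv, hi]
    exact ⟨k, Subgroup.subset_closure
      ⟨fun x => by rw [hk]; exact hσ, v, _, adj_nb c v i, hkv, hki⟩, hkv, hk v⟩
  obtain ⟨k, hk, hkv, hkg⟩ := hK (hg v)
  have hkv' : k⁻¹ v = v := by
    conv_lhs => rw [← hkv]
    exact RelIso.inv_apply_self k v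
  have h1 : k⁻¹ * g ∈ universalGroupPlus c F := by
    refine Subgroup.subset_closure ⟨mul_mem (inv_mem (plus_le c hk)) hg, v,
      c.nb v ⟨0, hd⟩, adj_nb c v _, by rw [RelIso.mul_apply, hv, hkv'], ?_⟩
    rw [RelIso.mul_apply, map_nb, hv, ← hkg]
    conv_lhs => rw [← hkv]
    rw [hkv, show c.nb v (localPerm c k v ⟨0, hd⟩) = k (c.nb v ⟨0, hd⟩) by rw [map_nb, hkv]]
    exact RelIso.inv_apply_self _ _
  have := mul_mem hk h1
  rwa [mul_inv_cancel_left] at this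

theorem exists_plus_map_adj (hF : IsTwoTransitive F) (hd : 3 ≤ d)
    (hgen : ∀ K : Subgroup (Equiv.Perm (Fin d)), (∀ σ ∈ F, ∀ i, σ i = i → σ ∈ K) → F ≤ K)
    {v u u' : V} (hu : T.Adj v u) (hu' : T.Adj v u') :
    ∃ g ∈ universalGroupPlus c F, g v = v ∧ g u = u' := by
  obtain ⟨a, ha, hau, -⟩ := exists_adj_ne c hd v u u
  obtain ⟨b, hb, hbu, -⟩ := exists_adj_ne c hd v u' u'
  obtain ⟨σ, hσ, h3, -⟩ := hF (c.col hu) (c.col ha) (c.col hu') (c.col hb)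
    (fun e => hau (col_injective c ha hu e.symm)) (fun e => hbu (col_injective c hb hu' e.symm))
  obtain ⟨g, hgv, hg⟩ := exists_constant_localPerm c hT v v σ
  refine ⟨g, stabilizer_le_plus c hT hgen (fun x => by rw [hg]; exact hσ) hgv (by omega), hgv, ?_⟩
  rw [← nb_col c hu, map_nb, hgv, hg, h3, nb_col]

/-- The `U(F)⁺`-orbit of `v` contains `v'` or every neighbour of `v'`. -/
theorem exists_plus_map (hF : IsTwoTransitive F) (hd : 3 ≤ d)
    (hgen : ∀ K : Subgroup (Equiv.Perm (Fin d)), (∀ σ ∈ F, ∀ i, σ i = i → σ ∈ K) → F ≤ K)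
    (v v' : V) : (∃ g ∈ universalGroupPlus c F, g v = v') ∨
      ∀ u, T.Adj v' u → ∃ g ∈ universalGroupPlus c F, g v = u := by
  refine induction_on_nb c hT (P := fun v' => (∃ g ∈ universalGroupPlus c F, g v = v') ∨
      ∀ u, T.Adj v' u → ∃ g ∈ universalGroupPlus c F, g v = u) v
      (Or.inl ⟨1, one_mem _, rfl⟩) ?_ v'
  rintro x i (⟨g, hg, rfl⟩ | h)
  · refine Or.inr fun u hu => ?_
    obtain ⟨k, hk, -, hku⟩ := exists_plus_map_adj c hT hF hd hgen (adj_nb c (g v) i).symm hu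
    exact ⟨k * g, mul_mem hk hg, hku⟩
  · exact Or.inl (h _ (adj_nb c x i))

/-- Every half-tree can be moved into any other half-tree. -/
theorem exists_branch_subset (hF : IsTwoTransitive F) (hd : 3 ≤ d)
    (hgen : ∀ K : Subgroup (Equiv.Perm (Fin d)), (∀ σ ∈ F, ∀ i, σ i = i → σ ∈ K) → F ≤ K)
    {v w v' w' : V} (h : T.Adj v w) (h' : T.Adj v' w') :
    ∃ g ∈ universalGroupPlus c F, branch T (g v') (g w') ⊆ branch T v w := by
  rcases exists_plus_map c hT hF hd hgen v' v with ⟨g, hg, hgv⟩ | hall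
  · have h1 := adj_map g h'
    rw [hgv] at h1
    obtain ⟨k, hk, hkv, hkw⟩ := exists_plus_map_adj c hT hF hd hgen h1 h
    refine ⟨k * g, mul_mem hk hg, ?_⟩
    rw [RelIso.mul_apply, RelIso.mul_apply, hgv, hkv, hkw]
  · obtain ⟨g, hg, hgv⟩ := hall w h
    obtain ⟨u, hu, huv, -⟩ := exists_adj_ne c hd w v v
    have h1 := adj_map g h'
    rw [hgv] at h1
    obtain ⟨k, hk, hkv, hkw⟩ := exists_plus_map_adj c hT hF hd hgen h1 hu
    refine ⟨k * g, mul_mem hk hg, ?_⟩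
    rw [RelIso.mul_apply, RelIso.mul_apply, hgv, hkv, hkw]
    exact branch_child_subset hT h hu huv

/-- Every half-tree contains infinitely many pairwise disjoint half-trees. -/
theorem exists_disjoint_branches (c : Coloring T d) (hd : 3 ≤ d) {v w : V} (h : T.Adj v w) :
    ∃ p y : ℕ → V, (∀ k, T.Adj (p k) (y k)) ∧
      (Pairwise fun k l => Disjoint (branch T (p k) (y k)) (branch T (p l) (y l))) ∧
      ∀ k, branch T (p k) (y k) ⊆ branch T v w := by
  have step : ∀ e : T.Dart, ∃ e₁ e₂ : T.Dart, branch T e₁.fst e₁.snd ⊆ branch T e.fst e.snd ∧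
      branch T e₂.fst e₂.snd ⊆ branch T e.fst e.snd ∧
      Disjoint (branch T e₁.fst e₁.snd) (branch T e₂.fst e₂.snd) := by
    intro e
    obtain ⟨a, ha, hae, -⟩ := exists_adj_ne c hd e.snd e.fst e.fst
    obtain ⟨b, hb, hbe, hab⟩ := exists_adj_ne c hd e.snd e.fst a
    exact ⟨⟨(e.snd, a), ha⟩, ⟨(e.snd, b), hb⟩, branch_child_subset hT e.adj ha hae,
      branch_child_subset hT e.adj hb hbe, branch_disjoint_of_ne hT ha hb hab.symm⟩
  choose f₁ f₂ h₁ h₂ h₃ using step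
  let e : ℕ → T.Dart := fun n => f₁^[n] ⟨(v, w), h⟩
  have he : ∀ n, e (n + 1) = f₁ (e n) := fun n => Function.iterate_succ_apply' f₁ n _
  have hmono : ∀ n m, n ≤ m → branch T (e m).fst (e m).snd ⊆ branch T (e n).fst (e n).snd := by
    intro n m hnm
    induction m, hnm using Nat.le_induction with
    | base => exact subset_rfl
    | succ m _ ih => rw [he]; exact (h₁ _).trans ih
  have hlt : ∀ k l, k < l → Disjoint (branch T (f₂ (e k)).fst (f₂ (e k)).snd)
      (branch T (f₂ (e l)).fst (f₂ (e l)).snd) := by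
    intro k l hkl
    refine Disjoint.mono_right ((h₂ (e l)).trans (hmono (k + 1) l hkl)) ?_
    rw [he]
    exact (h₃ (e k)).symm
  refine ⟨fun k => (f₂ (e k)).fst, fun k => (f₂ (e k)).snd, fun k => (f₂ (e k)).adj, ?_, ?_⟩
  · intro k l hkl
    rcases lt_or_gt_of_ne hkl with h | h
    · exact hlt k l h
    · exact (hlt l k h).symm
  · exact fun k => (h₂ (e k)).trans (hmono 0 k (Nat.zero_le k))

/-- An automorphism fixing `v` and moving `x` moves some ancestor of `x` with a fixed parent. -/
theorem exists_moved_ancestor {v : V} {g : T ≃g T} (hv : g v = v) {x : V} (hx : g x ≠ x) :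
    ∃ p y, T.Adj p y ∧ T.dist v y = T.dist v p + 1 ∧ g p = p ∧ g y ≠ y ∧
      x ∈ branch T p y := by
  induction hn : T.dist v x generalizing x with
  | zero => exact absurd hv (by rwa [(hT.connected.dist_eq_zero_iff).1 hn])
  | succ n ih =>
    have hne : x ≠ v := by rintro rfl; exact hx hv
    obtain ⟨q, hq, hd⟩ := exists_parent hT hne
    by_cases hgq : g q = q
    · exact ⟨q, x, hq.symm, hd, hgq, hx, mem_branch_right hq.symm⟩
    · obtain ⟨p, y, h1, h2, h3, h4, h5⟩ := ih hgq (by omega)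
      refine ⟨p, y, h1, h2, h3, h4, ?_⟩
      by_contra hxn
      obtain ⟨rfl, rfl⟩ := eq_of_adj_of_mem_branch hT h1 hq.symm h5 hxn
      omega

theorem branch_subset_of_mem {v w p y x : V} (h : T.Adj v w) (hpy : T.Adj p y)
    (hd : T.dist v y = T.dist v p + 1) (hx : x ∈ branch T v w) (hx' : x ∈ branch T p y) :
    branch T p y ⊆ branch T v w := by
  have hv := not_mem_branch_of_parent hd
  by_cases hp : p ∈ branch T v w
  · exact branch_subset hT h hpy hv hp
  · by_cases hne : v = p ∧ w = y
    · obtain ⟨rfl, rfl⟩ := hne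
      exact subset_rfl
    · exact absurd hx' (Set.disjoint_left.1 (branch_disjoint hT h hpy hv hp (by tauto)) hx)

/-- A nontrivial element supported in a half-tree moves some smaller half-tree off itself. -/
theorem exists_moved_branch {v w : V} (h : T.Adj v w) {g : T ≃g T}
    (hg : g ∈ rigid c F (branch T v w)) (hne : g ≠ 1) :
    ∃ p y, T.Adj p y ∧ branch T p y ⊆ branch T v w ∧
      Disjoint (branch T (g p) (g y)) (branch T p y) := by
  obtain ⟨x, hx⟩ : ∃ x, g x ≠ x := by
    by_contra hall
    push Not at hall
    exact hne (RelIso.ext hall)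
  have hxb : x ∈ branch T v w := by
    by_contra hxb
    exact hx (hg.2 x hxb)
  obtain ⟨p, y, h1, h2, h3, h4, h5⟩ := exists_moved_ancestor hT (fixes_left c hg) hx
  refine ⟨p, y, h1, branch_subset_of_mem hT h h1 h2 hxb h5, ?_⟩
  have h6 := adj_map g h1
  rw [h3] at h6 ⊢
  exact branch_disjoint_of_ne hT h6 h1 h4

/-- The group of a half-tree is transitive on its vertices at a given depth. -/
theorem exists_rigid_map_depth (hF : IsTwoTransitive F) {v w : V} (h : T.Adj v w) {y y' : V}
    (hy : y ∈ branch T v w) (hy' : y' ∈ branch T v w) (hd : T.dist v y = T.dist v y') :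
    ∃ g ∈ rigid c F (branch T v w), g y = y' := by
  induction hn : T.dist v y generalizing y y' with
  | zero =>
    refine absurd hy ?_
    rw [← (hT.connected.dist_eq_zero_iff).1 hn]
    exact not_mem_branch_left
  | succ n ih =>
    have hvw := SimpleGraph.dist_eq_one_iff_adj.2 h
    by_cases hyw : y = w
    · subst hyw
      refine ⟨1, one_mem _, ?_⟩
      by_contra hne
      have := dist_lt_of_mem_branch hT h (by rw [hvw, SimpleGraph.dist_self]) hy' (Ne.symm hne)
      omega
    · have hyw' : y' ≠ w := by
        rintro rfl
        have := dist_lt_of_mem_branch hT h (by rw [hvw, SimpleGraph.dist_self]) hy hyw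
        omega
      have par : ∀ z, z ∈ branch T v w → z ≠ w → ∃ p, T.Adj z p ∧
          T.dist v z = T.dist v p + 1 ∧ p ∈ branch T v w := by
        intro z hz hzw
        obtain ⟨p, hp, hpd⟩ := exists_parent hT (v := v) (x := z)
          (by rintro rfl; exact not_mem_branch_left hz)
        refine ⟨p, hp, hpd, ?_⟩
        by_contra hpb
        exact hzw (eq_of_adj_of_mem_branch hT h hp hz hpb).1
      obtain ⟨p, hp, hpd, hpb⟩ := par y hy hyw
      obtain ⟨p', hp', hpd', hpb'⟩ := par y' hy' hyw'
      obtain ⟨g, hg, hgp⟩ := ih hpb hpb' (by omega) (by omega)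
      have hp'v : p' ≠ v := by rintro rfl; exact not_mem_branch_left hpb'
      obtain ⟨q, hq, hqd⟩ := exists_parent hT hp'v
      have hgv := fixes_left c hg
      have h1 : T.Adj p' (g y) := by rw [← hgp]; exact adj_map g hp.symm
      have h2 : T.dist v (g y) = T.dist v y := by
        conv_lhs => rw [← hgv]
        rw [dist_map]
      obtain ⟨k, hk, hky⟩ := exists_rigid_map_adj c hT hF hq.symm h1 hp'.symm
        (by rintro e; rw [e] at h2; omega) (by rintro e; rw [e] at hpd'; omega)
      refine ⟨k * g, mul_mem (rigid_mono c ?_ hk) hg, hky⟩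
      exact branch_subset_of_mem hT h hq.symm hqd hpb' (mem_branch_right hq.symm)

/-- The pointwise stabilizer of an edge is the product of the groups of its two half-trees. -/
theorem mem_of_fixes_edge {v w : V} (h : T.Adj v w) {H : Subgroup (T ≃g T)}
    (h₁ : rigid c F (branch T v w) ≤ H) (h₂ : rigid c F (branch T w v) ≤ H) {g : T ≃g T}
    (hg : g ∈ universalGroup c F) (hv : g v = v) (hw : g w = w) : g ∈ H := by
  obtain ⟨r, hr, hrg⟩ := exists_restrict c hT h hg hv hw
  have : r⁻¹ * g ∈ rigid c F (branch T w v) := by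
    refine ⟨mul_mem (inv_mem hr.1) hg, fun x hx => ?_⟩
    rw [mem_branch_symm_iff hT h, not_not] at hx
    rw [RelIso.mul_apply, ← hrg x hx, RelIso.inv_apply_self]
  have := mul_mem (h₁ hr) (h₂ this)
  rwa [mul_inv_cancel_left] at this

/-- The stabilizer of a vertex is generated by the pointwise stabilizers of any two edges at it. -/
theorem stabilizer_le_of_two_edges (hF : IsTwoTransitive F) (hd : 3 ≤ d) {v a b : V}
    (ha : T.Adj v a) (hb : T.Adj v b) (hab : a ≠ b) {H : Subgroup (T ≃g T)}
    (hHa : ∀ g ∈ universalGroup c F, g v = v → g a = a → g ∈ H)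
    (hHb : ∀ g ∈ universalGroup c F, g v = v → g b = b → g ∈ H)
    {g : T ≃g T} (hg : g ∈ universalGroup c F) (hv : g v = v) : g ∈ H := by
  -- it suffices to move `u = g a` back to `a` inside `H`
  have back : ∀ u, T.Adj v u → ∃ k ∈ universalGroup c F, k ∈ H ∧ k v = v ∧ k u = a := by
    have tr : ∀ a', T.Adj v a' → ∀ u u', T.Adj v u → T.Adj v u' → u ≠ a' → u' ≠ a' →
        ∃ k ∈ universalGroup c F, k v = v ∧ k a' = a' ∧ k u = u' := by
      intro a' ha' u u' hu hu' hne hne'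
      obtain ⟨k, hk, hku⟩ := exists_rigid_map_adj c hT hF ha'.symm hu hu' hne hne'
      exact ⟨k, hk.1, fixes_right c hT ha'.symm hk, fixes_left c hk, hku⟩
    have main : ∀ u, T.Adj v u → u ≠ b →
        ∃ k ∈ universalGroup c F, k ∈ H ∧ k v = v ∧ k u = a := by
      intro u hu hub
      obtain ⟨k, hk, hkv, hkb, hku⟩ := tr b hb u a hu ha hub hab
      exact ⟨k, hk, hHb k hk hkv hkb, hkv, hku⟩
    intro u hu
    by_cases hub : u = b
    · obtain ⟨m, hm, hma, hmb⟩ := exists_adj_ne c hd v a b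
      obtain ⟨k, hk, hkv, hka, hku⟩ := tr a ha u m hu hm (by rw [hub]; exact hab.symm) hma
      obtain ⟨l, hl, hlH, hlv, hlm⟩ := main m hm hmb
      exact ⟨l * k, mul_mem hl hk, mul_mem hlH (hHa k hk hkv hka),
        by rw [RelIso.mul_apply, hkv, hlv], by rw [RelIso.mul_apply, hku, hlm]⟩
    · exact main u hu hub
  have hga := adj_map g ha
  rw [hv] at hga
  obtain ⟨k, hk, hkH, hkv, hka⟩ := back _ hga
  have : k * g ∈ H := hHa _ (mul_mem hk hg) (by rw [RelIso.mul_apply, hv, hkv]) hka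
  have := mul_mem (inv_mem hkH) this
  rwa [inv_mul_cancel_left] at this

/-- The stabilizers of two adjacent vertices generate `U(F)⁺`. -/
theorem plus_le_of_stabilizers (hF : IsTwoTransitive F) (hd : 3 ≤ d)
    (hgen : ∀ K : Subgroup (Equiv.Perm (Fin d)), (∀ σ ∈ F, ∀ i, σ i = i → σ ∈ K) → F ≤ K)
    {v w : V} (h : T.Adj v w) {H : Subgroup (T ≃g T)}
    (hv : ∀ g ∈ universalGroup c F, g v = v → g ∈ H)
    (hw : ∀ g ∈ universalGroup c F, g w = w → g ∈ H) : universalGroupPlus c F ≤ H := by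
  have step : ∀ x y z, T.Adj x y → T.Adj y z → (∀ g ∈ universalGroup c F, g x = x → g ∈ H) →
      (∀ g ∈ universalGroup c F, g y = y → g ∈ H) →
      ∀ g ∈ universalGroup c F, g z = z → g ∈ H := by
    intro x y z hxy hyz hx hy g hg hgz
    obtain ⟨k, hk, hky, hkx⟩ := exists_plus_map_adj c hT hF hd hgen hxy.symm hyz
    have hkU := plus_le c hk
    have hkH := hy k hkU hky
    have h1 : k⁻¹ * g * k ∈ H := by
      refine hx _ (mul_mem (mul_mem (inv_mem hkU) hg) hkU) ?_
      rw [RelIso.mul_apply, RelIso.mul_apply, hkx, hgz, ← hkx, RelIso.inv_apply_self]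
    have := mul_mem (mul_mem hkH h1) (inv_mem hkH)
    rwa [show k * (k⁻¹ * g * k) * k⁻¹ = g by group] at this
  have all : ∀ x, (∀ g ∈ universalGroup c F, g x = x → g ∈ H) ∧
      ∀ i, ∀ g ∈ universalGroup c F, g (c.nb x i) = c.nb x i → g ∈ H :=
    induction_on_nb c hT v
      ⟨hv, fun i => step w v _ h.symm (adj_nb c v i) hw hv⟩ fun x i ⟨h1, h2⟩ =>
      ⟨h2 i, fun j => step x _ _ (adj_nb c x i) (adj_nb c _ j) h1 (h2 i)⟩
  refine (Subgroup.closure_le _).2 ?_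
  rintro g ⟨hg, x, y, -, hx, -⟩
  exact (all x).1 g hg hx

end Tree

end

/-! ### The permutation topology -/

section

open Topology Filter

variable {V : Type*} {T : SimpleGraph V} {d : ℕ} (c : Coloring T d)
  {F : Subgroup (Equiv.Perm (Fin d))}

theorem isClosed_eval (x y : V) : IsClosed {g : T ≃g T | g x = y} := by
  let _ : TopologicalSpace V := ⊥
  have _ : DiscreteTopology V := ⟨rfl⟩
  have h : Continuous fun (g : T ≃g T) (v : V) => g v := continuous_induced_dom
  exact (isClosed_discrete {y}).preimage ((continuous_apply x).comp h)

theorem tendsto_iff {α : Type*} {l : Filter α} {f : α → (T ≃g T)} {g : T ≃g T} :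
    Tendsto f l (𝓝 g) ↔ ∀ x, ∀ᶠ a in l, f a x = g x := by
  let _ : TopologicalSpace V := ⊥
  have _ : DiscreteTopology V := ⟨rfl⟩
  have h : IsInducing fun (g : T ≃g T) (v : V) => g v := ⟨rfl⟩
  rw [h.tendsto_nhds_iff, tendsto_pi_nhds]
  refine forall_congr' fun x => ?_
  rw [nhds_discrete, tendsto_pure]
  rfl

theorem eventually_eval_eq (g : T ≃g T) (x : V) : ∀ᶠ k in 𝓝 g, k x = g x :=
  tendsto_iff.1 tendsto_id x

theorem exists_finite_of_mem_nhds {g : T ≃g T} {s : Set (T ≃g T)} (hs : s ∈ 𝓝 g) :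
    ∃ B : Set V, B.Finite ∧ ∀ k : T ≃g T, (∀ x ∈ B, k x = g x) → k ∈ s := by
  let _ : TopologicalSpace V := ⊥
  have _ : DiscreteTopology V := ⟨rfl⟩
  have h : IsInducing fun (g : T ≃g T) (v : V) => g v := ⟨rfl⟩
  rw [h.nhds_eq_comap, nhds_pi, mem_comap] at hs
  obtain ⟨t, ht, hts⟩ := hs
  obtain ⟨I, hI, u, hu, hut⟩ := mem_pi.1 ht
  refine ⟨I, hI, fun k hk => hts (hut fun x hx => ?_)⟩
  have := hk x hx
  change k x ∈ u x
  rw [this]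
  exact mem_of_mem_nhds (hu x)

instance : IsTopologicalGroup (T ≃g T) where
  continuous_mul := continuous_iff_continuousAt.2 fun ⟨g, h⟩ => tendsto_iff.2 fun x => by
    filter_upwards [Filter.Eventually.prod_nhds (eventually_eval_eq g (h x))
      (eventually_eval_eq h x)] with k hk
    rw [RelIso.mul_apply, RelIso.mul_apply, hk.2, hk.1]
  continuous_inv := continuous_iff_continuousAt.2 fun g => tendsto_iff.2 fun x => by
    filter_upwards [eventually_eval_eq g (g⁻¹ x)] with k hk
    rw [RelIso.apply_inv_self] at hk
    exact k.injective (by rw [RelIso.apply_inv_self, hk])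

instance : T2Space (T ≃g T) := by
  let _ : TopologicalSpace V := ⊥
  have _ : DiscreteTopology V := ⟨rfl⟩
  exact T2Space.of_injective_continuous (f := fun (g : T ≃g T) (v : V) => g v)
    (fun g h e => RelIso.ext (congrFun e)) continuous_induced_dom

theorem isClosed_universalGroup : IsClosed (universalGroup c F : Set (T ≃g T)) := by
  refine isClosed_iff_frequently.2 fun g hg v => ?_
  have h1 : ∀ᶠ k in 𝓝 g, localPerm c k v = localPerm c g v := by
    have h2 : ∀ᶠ k in 𝓝 g, ∀ i, k (c.nb v i) = g (c.nb v i) :=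
      eventually_all.2 fun i => eventually_eval_eq g _
    filter_upwards [eventually_eval_eq g v, h2] with k hk hk'
    exact localPerm_congr c hk fun w hw => by rw [← nb_col c hw]; exact hk' _
  obtain ⟨k, hk, hk'⟩ := (hg.and_eventually h1).exists
  rw [← hk']
  exact hk v

theorem isClosed_rigid (S : Set V) : IsClosed (rigid c F S : Set (T ≃g T)) := by
  have : (rigid c F S : Set (T ≃g T)) =
      (universalGroup c F : Set (T ≃g T)) ∩ ⋂ x ∈ Sᶜ, {g | g x = x} := by
    ext g
    simp [mem_rigid]
  rw [this]
  exact (isClosed_universalGroup c).inter (isClosed_biInter fun x _ => isClosed_eval x x)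

section Tree

variable (hT : T.IsTree)
include hT

theorem finite_ball (c : Coloring T d) (v : V) (n : ℕ) : {x | T.dist v x ≤ n}.Finite := by
  induction n with
  | zero =>
    refine (Set.finite_singleton v).subset fun x hx => ?_
    exact ((hT.connected.dist_eq_zero_iff).1 (Nat.le_zero.1 hx)).symm
  | succ n ih =>
    refine ((Set.finite_singleton v).union (ih.biUnion fun y _ =>
      Set.finite_range (c.nb y))).subset fun x hx => ?_
    by_cases hxv : x = v
    · exact Or.inl hxv
    · obtain ⟨y, hy, hd⟩ := exists_parent hT hxv
      refine Or.inr (Set.mem_biUnion (x := y) ?_ ⟨c.col hy.symm, nb_col c hy.symm⟩)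
      change T.dist v x ≤ n + 1 at hx
      change T.dist v y ≤ n
      omega

/-- Automorphisms moving a given vertex into a finite set form a compact set. -/
theorem isCompact_setOf_apply_mem (c : Coloring T d) (v : V) {S : Set V} (hS : S.Finite) :
    IsCompact {g : T ≃g T | g v ∈ S} := by
  rw [isCompact_iff_ultrafilter_le_nhds]
  intro 𝒰 h𝒰
  rw [le_principal_iff] at h𝒰
  obtain ⟨N, hN⟩ : ∃ N, ∀ s ∈ S, T.dist v s ≤ N := by
    obtain ⟨N, hN⟩ := (hS.image fun s => T.dist v s).bddAbove
    exact ⟨N, fun s hs => hN ⟨s, hs, rfl⟩⟩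
  -- an ultrafilter concentrated on finitely many values picks one of them
  have pick : ∀ (f : (T ≃g T) → V) (B : Set V), B.Finite → (∀ᶠ g in 𝒰, f g ∈ B) →
      ∃ y, ∀ᶠ g in 𝒰, f g = y := by
    intro f B hB hf
    obtain ⟨y, -, hy⟩ := Ultrafilter.eq_pure_of_finite_mem (f := 𝒰.map f) hB hf
    refine ⟨y, ?_⟩
    have : {y} ∈ 𝒰.map f := by rw [hy]; exact Ultrafilter.mem_pure.2 rfl
    exact this
  have h1 : ∀ x, ∃ y, ∀ᶠ g : T ≃g T in 𝒰, g x = y := fun x => by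
    refine pick (fun g => g x) _ (finite_ball hT c v (N + T.dist v x)) ?_
    filter_upwards [h𝒰] with g hg
    have h2 := hT.connected.dist_triangle (u := v) (v := g v) (w := g x)
    have h3 := hN _ hg
    rw [dist_map] at h2
    exact h2.trans (by omega)
  have h2 : ∀ x, ∃ y, ∀ᶠ g : T ≃g T in 𝒰, g⁻¹ x = y := fun x => by
    refine pick (fun g => g⁻¹ x) _ (finite_ball hT c v (N + T.dist v x)) ?_
    filter_upwards [h𝒰] with g hg
    have h2 := hT.connected.dist_triangle (u := g v) (v := v) (w := x)
    have h3 := hN _ hg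
    have h4 : T.dist v (g⁻¹ x) = T.dist (g v) x := by
      rw [← dist_map g, RelIso.apply_inv_self]
    rw [SimpleGraph.dist_comm (u := g v) (v := v)] at h2
    change T.dist v (g⁻¹ x) ≤ _
    omega
  choose φ hφ using h1
  choose ψ hψ using h2
  have hne : ∀ {p : (T ≃g T) → Prop}, (∀ᶠ g in 𝒰, p g) → ∃ g, p g := fun h => h.exists
  let g₀ : T ≃g T :=
    { toFun := φ
      invFun := ψ
      left_inv := fun x => by
        obtain ⟨g, hg, hg'⟩ := hne ((hφ x).and (hψ (φ x)))
        rw [← hg', ← hg, RelIso.inv_apply_self]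
      right_inv := fun x => by
        obtain ⟨g, hg, hg'⟩ := hne ((hφ (ψ x)).and (hψ x))
        rw [← hg, ← hg', RelIso.apply_inv_self]
      map_rel_iff' := fun {x y} => by
        obtain ⟨g, hg, hg'⟩ := hne ((hφ x).and (hφ y))
        change T.Adj (φ x) (φ y) ↔ _
        rw [← hg, ← hg']
        exact g.map_rel_iff }
  have hlim : Tendsto id (𝒰 : Filter (T ≃g T)) (𝓝 g₀) := tendsto_iff.2 hφ
  refine ⟨g₀, ?_, hlim⟩
  obtain ⟨g, hg, hg'⟩ := hne ((hφ v).and h𝒰)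
  change φ v ∈ S
  rw [← hg]
  exact hg'

theorem isCompact_rigid_branch (v w : V) :
    IsCompact (rigid c F (branch T v w) : Set (T ≃g T)) :=
  (isCompact_setOf_apply_mem hT c v (Set.finite_singleton v)).of_isClosed_subset
    (isClosed_rigid c _) fun _ hg => fixes_left c hg

end Tree

end

/-! ### Commutators in the group of a half-tree -/

section

open Topology Filter
open scoped Pointwise commutatorElement

section CommutatorWidth

variable {G : Type*} [Group G]

/-- The set of commutators of elements of a subgroup. Its power `commutators A ^ k` is the set of
products of `k` commutators. -/
def commutators (A : Subgroup G) : Set G := {z | ∃ x ∈ A, ∃ y ∈ A, ⁅x, y⁆ = z}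

theorem one_mem_commutators (A : Subgroup G) : 1 ∈ commutators A :=
  ⟨1, one_mem _, 1, one_mem _, by simp⟩

theorem commutators_pow_mono (A : Subgroup G) {m n : ℕ} (h : m ≤ n) :
    commutators A ^ m ⊆ commutators A ^ n :=
  Set.pow_subset_pow_right (one_mem_commutators A) h

theorem one_mem_commutators_pow (A : Subgroup G) (n : ℕ) : 1 ∈ commutators A ^ n :=
  Set.one_mem_pow (one_mem_commutators A)

theorem mem_of_mem_commutators_pow {A : Subgroup G} {k : ℕ} {z : G}
    (hz : z ∈ commutators A ^ k) : z ∈ A := by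
  induction k generalizing z with
  | zero => rw [pow_zero, Set.mem_one] at hz; rw [hz]; exact one_mem _
  | succ k ih =>
    rw [pow_succ'] at hz
    obtain ⟨_, ⟨x, hx, y, hy, rfl⟩, q, hq, rfl⟩ := hz
    exact mul_mem (mul_mem (mul_mem (mul_mem hx hy) (inv_mem hx)) (inv_mem hy)) (ih hq)

theorem conj_mem_commutators_pow {A B : Subgroup G} {s : G} (hs : ∀ x ∈ A, s * x * s⁻¹ ∈ B)
    {k : ℕ} {z : G} (hz : z ∈ commutators A ^ k) : s * z * s⁻¹ ∈ commutators B ^ k := by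
  induction k generalizing z with
  | zero => rw [pow_zero, Set.mem_one] at hz ⊢; rw [hz]; group
  | succ k ih =>
    rw [pow_succ'] at hz ⊢
    obtain ⟨_, ⟨x, hx, y, hy, rfl⟩, q, hq, rfl⟩ := hz
    refine ⟨_, ⟨_, hs x hx, _, hs y hy, rfl⟩, _, ih hq, ?_⟩
    simp only [commutatorElement_def]
    group

theorem commutator_mul_mul {x y x' y' : G} (hxx : Commute x x') (hxy : Commute x y')
    (hyx : Commute y x') (hyy : Commute y y') : ⁅x * x', y * y'⁆ = ⁅x, y⁆ * ⁅x', y'⁆ := by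
  have e1 : x' * y = y * x' := (hyx).eq.symm
  have e2 : x'⁻¹ * x⁻¹ = x⁻¹ * x'⁻¹ := (hxx).inv_inv.eq.symm
  have e3 : y' * x⁻¹ = x⁻¹ * y' := ((hxy).inv_left).eq.symm
  have e4 : y'⁻¹ * y⁻¹ = y⁻¹ * y'⁻¹ := (hyy).inv_inv.eq.symm
  have e5 : x' * x⁻¹ = x⁻¹ * x' := ((hxx).inv_left).eq.symm
  have e6 : x'⁻¹ * y⁻¹ = y⁻¹ * x'⁻¹ := (hyx).inv_inv.eq.symm
  have e7 : y' * y⁻¹ = y⁻¹ * y' := ((hyy).inv_left).eq.symm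
  have e8 : x' * y⁻¹ = y⁻¹ * x' := ((hyx).inv_left).eq.symm
  simp only [commutatorElement_def, mul_inv_rev]
  calc x * x' * (y * y') * (x'⁻¹ * x⁻¹) * (y'⁻¹ * y⁻¹)
      = x * (x' * y) * y' * (x'⁻¹ * x⁻¹) * (y'⁻¹ * y⁻¹) := by group
    _ = x * y * x' * (y' * x⁻¹) * x'⁻¹ * y⁻¹ * y'⁻¹ := by rw [e1, e2, e4]; group
    _ = x * y * (x' * x⁻¹) * y' * (x'⁻¹ * y⁻¹) * y'⁻¹ := by rw [e3]; group
    _ = x * y * x⁻¹ * x' * (y' * y⁻¹) * x'⁻¹ * y'⁻¹ := by rw [e5, e6]; group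
    _ = x * y * x⁻¹ * (x' * y⁻¹) * y' * x'⁻¹ * y'⁻¹ := by rw [e7]; group
    _ = x * y * x⁻¹ * y⁻¹ * (x' * y' * x'⁻¹ * y'⁻¹) := by rw [e8]; group

/-- Products of commutators from two commuting subgroups can be merged factor by factor. -/
theorem mul_mem_commutators_pow {A A' B : Subgroup G} (hA : A ≤ B) (hA' : A' ≤ B)
    (hc : ∀ x ∈ A, ∀ y ∈ A', Commute x y) {k : ℕ} {z z' : G}
    (hz : z ∈ commutators A ^ k) (hz' : z' ∈ commutators A' ^ k) :
    z * z' ∈ commutators B ^ k := by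
  induction k generalizing z z' with
  | zero =>
    rw [pow_zero, Set.mem_one] at hz hz' ⊢; rw [hz, hz', one_mul]
  | succ k ih =>
    rw [pow_succ'] at hz hz' ⊢
    obtain ⟨_, ⟨x, hx, y, hy, rfl⟩, q, hq, rfl⟩ := hz
    obtain ⟨_, ⟨x', hx', y', hy', rfl⟩, q', hq', rfl⟩ := hz'
    have hqA := mem_of_mem_commutators_pow hq
    refine ⟨_, ⟨x * x', mul_mem (hA hx) (hA' hx'), y * y', mul_mem (hA hy) (hA' hy'), rfl⟩,
      _, ih hq hq', ?_⟩
    have h1 : Commute q ⁅x', y'⁆ := by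
      rw [commutatorElement_def]
      exact ((((hc q hqA x' hx').mul_right (hc q hqA y' hy')).mul_right
        (hc q hqA x' hx').inv_right).mul_right (hc q hqA y' hy').inv_right)
    have h2 : ⁅x * x', y * y'⁆ = ⁅x, y⁆ * ⁅x', y'⁆ :=
      commutator_mul_mul (hc x hx x' hx') (hc x hx y' hy') (hc y hy x' hx') (hc y hy y' hy')
    change ⁅x * x', y * y'⁆ * (q * q') = ⁅x, y⁆ * q * (⁅x', y'⁆ * q')
    rw [h2, mul_assoc, mul_assoc, ← mul_assoc q, h1.eq, mul_assoc]

theorem inv_mem_commutators_pow {A : Subgroup G} {k : ℕ} {z : G}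
    (hz : z ∈ commutators A ^ k) : z⁻¹ ∈ commutators A ^ k := by
  have h1 : (commutators A)⁻¹ = commutators A := by
    ext z
    rw [Set.mem_inv]
    constructor
    · rintro ⟨x, hx, y, hy, h⟩
      exact ⟨y, hy, x, hx, by rw [← commutatorElement_inv, h, inv_inv]⟩
    · rintro ⟨x, hx, y, hy, h⟩
      exact ⟨y, hy, x, hx, by rw [← commutatorElement_inv, h]⟩
  rw [← h1, inv_pow, Set.inv_mem_inv]
  exact hz

/-- In a perfect subgroup every element is a product of commutators. -/
theorem exists_mem_commutators_pow {A : Subgroup G} (hA : ⁅A, A⁆ = A) {z : G} (hz : z ∈ A) :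
    ∃ k, z ∈ commutators A ^ k := by
  rw [← hA, Subgroup.commutator_def] at hz
  refine Subgroup.closure_induction (p := fun z _ => ∃ k, z ∈ commutators A ^ k) ?_ ?_ ?_ ?_ hz
  · exact fun z hz => ⟨1, by rw [pow_one]; exact hz⟩
  · exact ⟨0, by simp⟩
  · rintro x y - - ⟨k, hk⟩ ⟨l, hl⟩
    exact ⟨k + l, by rw [pow_add]; exact Set.mul_mem_mul hk hl⟩
  · rintro x - ⟨k, hk⟩
    exact ⟨k, inv_mem_commutators_pow hk⟩

theorem isCompact_commutators_pow [TopologicalSpace G] [IsTopologicalGroup G] {A : Subgroup G}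
    (hA : IsCompact (A : Set G)) (k : ℕ) : IsCompact (commutators A ^ k) := by
  have h1 : IsCompact (commutators A) := by
    have : commutators A = (fun p : G × G => p.1 * p.2 * p.1⁻¹ * p.2⁻¹) '' ((A : Set G) ×ˢ A) := by
      ext z
      constructor
      · rintro ⟨x, hx, y, hy, rfl⟩
        exact ⟨(x, y), ⟨hx, hy⟩, rfl⟩
      · rintro ⟨⟨x, y⟩, ⟨hx, hy⟩, rfl⟩
        exact ⟨x, hx, y, hy, rfl⟩
    rw [this]
    exact (hA.prod hA).image (by fun_prop)
  induction k with
  | zero => rw [pow_zero]; exact isCompact_singleton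
  | succ k ih => rw [pow_succ]; exact ih.mul h1

end CommutatorWidth

variable {V : Type*} {T : SimpleGraph V} {d : ℕ} (c : Coloring T d)
  {F : Subgroup (Equiv.Perm (Fin d))}

/-- The stabilizer of a color in `F`, as a subgroup of the symmetric group. -/
def pointStabilizer (F : Subgroup (Equiv.Perm (Fin d))) (i : Fin d) :
    Subgroup (Equiv.Perm (Fin d)) := F ⊓ MulAction.stabilizer (Equiv.Perm (Fin d)) i

/-- The commutator width of the point stabilizers is uniformly bounded. -/
theorem exists_commutator_width (hperf : ∀ i, ⁅pointStabilizer F i, pointStabilizer F i⁆ =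
    pointStabilizer F i) :
    ∃ N : ℕ, ∀ i, ∀ σ ∈ pointStabilizer F i, σ ∈ commutators (pointStabilizer F i) ^ N := by
  choose k hk using fun p : Σ i, pointStabilizer F i =>
    exists_mem_commutators_pow (hperf p.1) p.2.2
  obtain ⟨N, hN⟩ := (Set.finite_range k).bddAbove
  exact ⟨N, fun i σ hσ => commutators_pow_mono _ (hN ⟨⟨i, σ, hσ⟩, rfl⟩) (hk ⟨i, σ, hσ⟩)⟩

section Tree

variable (hT : T.IsTree)
include hT

/-- Products of commutators of local permutations at the root of a half-tree lift to products of
commutators in the group of the half-tree. -/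
theorem exists_lift_commutators {v w : V} (h : T.Adj v w) {k : ℕ} {σ : Equiv.Perm (Fin d)}
    (hσ : σ ∈ commutators (pointStabilizer F (c.col h)) ^ k) :
    ∃ z ∈ commutators (rigid c F (branch T v w)) ^ k, localPerm c z w = σ := by
  have hinv : ∀ g ∈ rigid c F (branch T v w), localPerm c g⁻¹ w = (localPerm c g w)⁻¹ := by
    intro g hg
    have h1 := localPerm_mul c g g⁻¹ w
    rw [mul_inv_cancel, localPerm_one, fixes_right c hT h (inv_mem hg)] at h1
    exact eq_inv_of_mul_eq_one_right h1.symm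
  have hmul : ∀ g, ∀ g' ∈ rigid c F (branch T v w),
      localPerm c (g * g') w = localPerm c g w * localPerm c g' w := by
    intro g g' hg'
    rw [localPerm_mul, fixes_right c hT h hg']
  induction k generalizing σ with
  | zero =>
    rw [pow_zero, Set.mem_one] at hσ
    exact ⟨1, one_mem_commutators_pow _ _, by rw [hσ, localPerm_one]⟩
  | succ k ih =>
    rw [pow_succ'] at hσ
    obtain ⟨_, ⟨τ, hτ, ρ, hρ, rfl⟩, σ', hσ', rfl⟩ := hσ
    obtain ⟨z, hz, hzσ⟩ := ih hσ'
    obtain ⟨x, hx, hxτ⟩ := exists_rigid_localPerm c hT h hτ.1 hτ.2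
    obtain ⟨y, hy, hyρ⟩ := exists_rigid_localPerm c hT h hρ.1 hρ.2
    refine ⟨⁅x, y⁆ * z, ?_, ?_⟩
    · rw [pow_succ']
      exact Set.mul_mem_mul ⟨x, hx, y, hy, rfl⟩ hz
    · rw [hmul _ _ (mem_of_mem_commutators_pow hz), commutatorElement_def,
        hmul _ _ (inv_mem hy), hmul _ _ (inv_mem hx), hmul _ _ hy, hinv x hx, hinv y hy,
        hxτ, hyρ, hzσ, commutatorElement_def]

/-- Modulo one commutator for each child half-tree, an element that fixes the star of the root `w`
can be pushed into a single child half-tree. -/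
theorem exists_push (hF : IsTwoTransitive F) {v w u₀ : V} (h : T.Adj v w) (h₀ : T.Adj w u₀)
    (hu₀ : u₀ ≠ v) (S : Finset V) (hS : ∀ u ∈ S, T.Adj w u ∧ u ≠ v) {a : T ≃g T}
    (ha : a ∈ universalGroup c F) (haw : a w = w) (hau : ∀ u, T.Adj w u → a u = u)
    (hax : ∀ x, x ∉ branch T w u₀ → (∀ u ∈ S, x ∉ branch T w u) → a x = x) :
    ∃ z ∈ commutators (rigid c F (branch T v w)) ^ S.card,
      ∃ b ∈ rigid c F (branch T w u₀), a = z * b := by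
  classical
  induction S using Finset.induction_on generalizing a with
  | empty =>
    exact ⟨1, one_mem_commutators_pow _ _, a, ⟨ha, fun x hx => hax x hx (by simp)⟩,
      (one_mul a).symm⟩
  | insert u S hu ih =>
    have hS' : ∀ u ∈ S, T.Adj w u ∧ u ≠ v := fun u hu => hS u (Finset.mem_insert_of_mem hu)
    obtain ⟨hwu, huv⟩ := hS u (Finset.mem_insert_self u S)
    rw [Finset.card_insert_of_notMem hu]
    obtain ⟨r, hr, hra⟩ := exists_restrict c hT hwu ha haw (hau u hwu)
    obtain ⟨s, hs, hsu⟩ := exists_rigid_map_adj c hT hF h h₀ hwu hu₀ huv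
    have hsw := fixes_right c hT h hs
    have hrinv : ∀ {x}, r x = x → r⁻¹ x = x := fun {x} hx => by
      conv_lhs => rw [← hx]
      exact RelIso.inv_apply_self r x
    have hrA : r ∈ rigid c F (branch T v w) :=
      rigid_mono c (branch_child_subset hT h hwu huv) hr
    have hr0 : s⁻¹ * r * s ∈ rigid c F (branch T w u₀) := by
      have h1 := conj_mem_rigid_branch c (inv_mem hs.1) hr
      rw [inv_inv, ← hsu, RelIso.inv_apply_self] at h1
      have h2 : s⁻¹ w = w := fixes_right c hT h (inv_mem hs)
      rwa [h2] at h1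
    obtain ⟨z, hz, b, hb, hzb⟩ := ih hS' (a := r⁻¹ * a) (mul_mem (inv_mem hr.1) ha)
      (by rw [RelIso.mul_apply, haw, hrinv (fixes_left c hr)])
      (fun u' hu' => by
        rw [RelIso.mul_apply, hau u' hu']
        by_cases hx : u' ∈ branch T w u
        · exact hrinv (by rw [hra _ hx, hau u' hu'])
        · exact hrinv (hr.2 _ hx))
      (fun x hx hxS => by
        rw [RelIso.mul_apply]
        by_cases hxu : x ∈ branch T w u
        · rw [← hra x hxu, RelIso.inv_apply_self]
        · rw [hax x hx (by
            simp only [Finset.mem_insert]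
            rintro u' (rfl | hu')
            exacts [hxu, hxS _ hu'])]
          exact hrinv (hr.2 x hxu))
    have hb' : s⁻¹ * r * s ∈ rigid c F (branch T v w) :=
      rigid_mono c (branch_child_subset hT h h₀ hu₀) hr0
    refine ⟨⁅s, s⁻¹ * r * s⁆ * ((s⁻¹ * r * s) * z * (s⁻¹ * r * s)⁻¹), ?_,
      (s⁻¹ * r * s) * b, mul_mem hr0 hb, ?_⟩
    · rw [pow_succ']
      exact Set.mul_mem_mul ⟨s, hs, _, hb', rfl⟩ (conj_mem_commutators_pow
        (fun x hx => mul_mem (mul_mem hb' hx) (inv_mem hb')) hz)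
    · have h1 : a = r * (z * b) := by rw [← hzb, mul_inv_cancel_left]
      rw [h1, commutatorElement_def]
      group

/-- Every element of the group of a half-tree is, up to any given depth, a product of a fixed
number of commutators. The number is independent of the depth because a product of `m + m`
commutators in a child half-tree becomes a product of `m` commutators, up to one more commutator,
once its second half is moved into a sibling half-tree, where it commutes with the first. The count
`m + m = N + d + 1 + m` allows `N` commutators for the local permutation at the root, `d` for
pushing the rest into one child and one for the move. -/
theorem exists_approx_commutators (hF : IsTwoTransitive F) (hd : 3 ≤ d) {N m : ℕ}
    (hN : ∀ i, ∀ σ ∈ pointStabilizer F i, σ ∈ commutators (pointStabilizer F i) ^ N)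
    (hm : m = N + d + 1) (n : ℕ) {v w : V} (h : T.Adj v w) {a : T ≃g T}
    (ha : a ∈ rigid c F (branch T v w)) :
    ∃ z ∈ commutators (rigid c F (branch T v w)) ^ (m + m),
      ∃ ε ∈ rigid c F (branch T v w), (∀ x, T.dist w x ≤ n → ε x = x) ∧ a = z * ε := by
  classical
  induction n generalizing v w a with
  | zero =>
    refine ⟨1, one_mem_commutators_pow _ _, a, ha, fun x hx => ?_, (one_mul a).symm⟩
    rw [← (hT.connected.dist_eq_zero_iff).1 (Nat.le_zero.1 hx), fixes_right c hT h ha]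
  | succ n ih =>
    obtain ⟨u₀, h₀, hu₀, -⟩ := exists_adj_ne c hd w v v
    obtain ⟨u₁, h₁, hu₁, hu₀₁⟩ := exists_adj_ne c hd w v u₀
    set A := rigid c F (branch T v w) with hA
    have haw := fixes_right c hT h ha
    -- correct the local permutation at the root
    have hσ : localPerm c a w ∈ pointStabilizer F (c.col h) := by
      refine ⟨ha.1 w, ?_⟩
      change localPerm c a w (c.col h) = c.col h
      have h1 := map_nb c a w (c.col h.symm)
      rw [nb_col, haw, fixes_left c ha] at h1
      refine nb_injective c w ?_
      rw [← col_symm c h, ← h1, nb_col]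
    obtain ⟨z₀, hz₀, hz₀σ⟩ := exists_lift_commutators c hT h (hN _ _ hσ)
    have hz₀A := mem_of_mem_commutators_pow hz₀
    have ha' : z₀⁻¹ * a ∈ A := mul_mem (inv_mem hz₀A) ha
    have hstar : ∀ u, T.Adj w u → (z₀⁻¹ * a) u = u := by
      intro u hu
      have h1 : a u = z₀ u := by
        rw [← nb_col c hu, map_nb, map_nb, haw, fixes_right c hT h hz₀A, hz₀σ]
      rw [RelIso.mul_apply, h1, RelIso.inv_apply_self]
    -- push the rest into one child half-tree
    let S : Finset V := (Finset.univ.image (c.nb w)).filter (· ≠ v)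
    have hScard : S.card ≤ d :=
      (Finset.card_filter_le _ _).trans (Finset.card_image_le.trans (by simp))
    have hSmem : ∀ u ∈ S, T.Adj w u ∧ u ≠ v := by
      intro u hu
      obtain ⟨hu1, hu2⟩ := Finset.mem_filter.1 hu
      obtain ⟨i, -, rfl⟩ := Finset.mem_image.1 hu1
      exact ⟨adj_nb c w i, hu2⟩
    obtain ⟨z₁, hz₁, p, hp, hzp⟩ := exists_push c hT hF h h₀ hu₀ S hSmem ha'.1
      (fixes_right c hT h ha') hstar (fun x _ hx => by
        by_cases hxb : x ∈ branch T v w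
        · by_cases hxw : x = w
          · rw [hxw]; exact fixes_right c hT h ha'
          · obtain ⟨u, hu, huv, hxu⟩ := exists_child_of_mem_branch hT h hxb hxw
            refine absurd hxu (hx u (Finset.mem_filter.2 ⟨Finset.mem_image.2
              ⟨c.col hu, Finset.mem_univ _, nb_col c hu⟩, huv⟩))
        · exact ha'.2 x hxb)
    -- inside it, use the inductive hypothesis and merge two halves of the product
    obtain ⟨q, hq, ε, hε, hεn, hqε⟩ := ih h₀ hp
    rw [pow_add] at hq
    obtain ⟨q₁, hq₁, q₂, hq₂, rfl⟩ := hq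
    have hA₀ : rigid c F (branch T w u₀) ≤ A :=
      rigid_mono c (branch_child_subset hT h h₀ hu₀)
    have hA₁ : rigid c F (branch T w u₁) ≤ A :=
      rigid_mono c (branch_child_subset hT h h₁ hu₁)
    obtain ⟨s, hs, hsu⟩ := exists_rigid_map_adj c hT hF h h₀ h₁ hu₀ hu₁
    have hsw := fixes_right c hT h hs
    have ht₂ : s * q₂ * s⁻¹ ∈ commutators (rigid c F (branch T w u₁)) ^ m :=
      conj_mem_commutators_pow (fun x hx => by
        have := conj_mem_rigid_branch c hs.1 hx
        rwa [hsw, hsu] at this) hq₂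
    have hmerge : q₁ * (s * q₂ * s⁻¹) ∈ commutators A ^ m :=
      mul_mem_commutators_pow hA₀ hA₁ (fun x hx y hy => commute_of_disjoint c
        (branch_disjoint_of_ne hT h₀ h₁ hu₀₁.symm) hx hy) hq₁ ht₂
    have hq₁A := hA₀ (mem_of_mem_commutators_pow hq₁)
    have hcomm : q₁ * ⁅s⁻¹, s * q₂ * s⁻¹⁆ * q₁⁻¹ ∈ commutators A := by
      have := conj_mem_commutators_pow (k := 1)
        (fun x hx => mul_mem (mul_mem hq₁A hx) (inv_mem hq₁A))
        (by rw [pow_one]; exact ⟨s⁻¹, inv_mem hs, _, hA₁ (mem_of_mem_commutators_pow ht₂), rfl⟩)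
      rwa [pow_one] at this
    refine ⟨z₀ * (z₁ * ((q₁ * ⁅s⁻¹, s * q₂ * s⁻¹⁆ * q₁⁻¹) * (q₁ * (s * q₂ * s⁻¹)))), ?_,
      ε, hA₀ hε, ?_, ?_⟩
    · have e : m + m = N + (d + (1 + m)) := by omega
      rw [e, pow_add, pow_add, pow_add, pow_one]
      exact Set.mul_mem_mul hz₀ (Set.mul_mem_mul (commutators_pow_mono _ hScard hz₁)
        (Set.mul_mem_mul hcomm hmerge))
    · intro x hx
      by_cases hxb : x ∈ branch T w u₀
      · refine hεn x ?_
        have := dist_of_mem_branch hT h₀ hxb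
        rw [SimpleGraph.dist_comm (u := x) (v := w), SimpleGraph.dist_comm (u := x)] at this
        omega
      · exact hε.2 x hxb
    · have h1 : a = z₀ * (z₁ * (q₁ * q₂ * ε)) := by
        change p = q₁ * q₂ * ε at hqε
        rw [← hqε, ← hzp, mul_inv_cancel_left]
      rw [h1, commutatorElement_def]
      group

/-- The group of a half-tree is perfect: products of a fixed number of commutators are dense in it,
and form a compact set. -/
theorem rigid_branch_le_of_commutators (hF : IsTwoTransitive F) (hd : 3 ≤ d)
    (hperf : ∀ i, ⁅pointStabilizer F i, pointStabilizer F i⁆ = pointStabilizer F i)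
    {v w : V} (h : T.Adj v w) {H : Subgroup (T ≃g T)}
    (hH : ∀ a ∈ rigid c F (branch T v w), ∀ b ∈ rigid c F (branch T v w), ⁅a, b⁆ ∈ H) :
    rigid c F (branch T v w) ≤ H := by
  obtain ⟨N, hN⟩ := exists_commutator_width hperf
  obtain ⟨m, hm⟩ : ∃ m, m = N + d + 1 := ⟨_, rfl⟩
  intro a ha
  have hclosed := (isCompact_commutators_pow (isCompact_rigid_branch c hT (F := F) v w)
    (m + m)).isClosed
  have hmem : a ∈ commutators (rigid c F (branch T v w)) ^ (m + m) := by
    rw [← hclosed.closure_eq, mem_closure_iff_nhds]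
    intro t ht
    obtain ⟨B, hB, hBt⟩ := exists_finite_of_mem_nhds ht
    obtain ⟨n, hn⟩ := (hB.image fun x => T.dist w x).bddAbove
    obtain ⟨z, hz, ε, hε, hεn, rfl⟩ := exists_approx_commutators c hT hF hd hN hm n h ha
    refine ⟨z, hBt z fun x hx => ?_, hz⟩
    rw [RelIso.mul_apply, hεn x (hn ⟨x, hx, rfl⟩)]
  have key : ∀ k, commutators (rigid c F (branch T v w)) ^ k ⊆ H := by
    intro k
    induction k with
    | zero =>
      intro z hz
      rw [pow_zero, Set.mem_one] at hz
      rw [hz]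
      exact one_mem H
    | succ k ih =>
      rw [pow_succ']
      rintro _ ⟨_, ⟨x, hx, y, hy, rfl⟩, q, hq, rfl⟩
      exact mul_mem (hH x hx y hy) (ih hq)
  exact key _ hmem

end Tree

end

/-! ### Commutator tricks for commensurated subgroups -/

section

open Topology Filter
open scoped Pointwise commutatorElement

section Group

variable {Γ : Type*} [Group Γ]

/-- Every element of `G` conjugates a finite index subgroup of `H` into `H`. This is the form in
which commensurated subgroups of `G` are used; it does not ask for `H ≤ G`. -/
def Commensurates (G H : Subgroup Γ) : Prop :=
  ∀ a ∈ G, ∃ K ≤ H, K.relIndex H ≠ 0 ∧ ∀ k ∈ K, a * k * a⁻¹ ∈ H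

theorem exists_infinite_of_relIndex {K H : Subgroup Γ} (hK : K.relIndex H ≠ 0)
    {s : ℕ → Γ} (hs : ∀ n, s n ∈ H) :
    ∃ J : Set ℕ, J.Infinite ∧ ∀ i ∈ J, ∀ j ∈ J, (s i)⁻¹ * s j ∈ K := by
  have : (K.subgroupOf H).FiniteIndex := ⟨hK⟩
  obtain ⟨y, hy⟩ := Finite.exists_infinite_fiber
    fun n => (QuotientGroup.mk (⟨s n, hs n⟩ : H) : H ⧸ K.subgroupOf H)
  refine ⟨_, Set.infinite_coe_iff.1 hy, fun i hi j hj => ?_⟩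
  have h : (QuotientGroup.mk (⟨s i, hs i⟩ : H) : H ⧸ K.subgroupOf H) =
      QuotientGroup.mk (⟨s j, hs j⟩ : H) :=
    (show _ = y from hi).trans (show _ = y from hj).symm
  have h' := QuotientGroup.eq.1 h
  exact h'

/-- Pigeonhole principle for a commensurated subgroup: among infinitely many elements of `H`, some
infinite subfamily has all its quotients in the finite index subgroup of `H` that `a` conjugates
into `H`. -/
theorem Commensurates.exists_infinite {G H : Subgroup Γ} (hH : Commensurates G H) {a : Γ}
    (ha : a ∈ G) {s : ℕ → Γ} (hs : ∀ n, s n ∈ H) :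
    ∃ J : Set ℕ, J.Infinite ∧ ∀ i ∈ J, ∀ j ∈ J, ⁅a, (s i)⁻¹ * s j⁆ ∈ H := by
  obtain ⟨K, hKH, hK, hKa⟩ := hH a ha
  obtain ⟨J, hJ, hJs⟩ := exists_infinite_of_relIndex hK hs
  exact ⟨J, hJ, fun i hi j hj =>
    mul_mem (hKa _ (hJs i hi j hj)) (inv_mem (hKH (hJs i hi j hj)))⟩

theorem commutator_mul_left_eq {a m k : Γ} (h : Commute m k) : ⁅a * m, k⁆ = ⁅a, k⁆ := by
  rw [commutatorElement_def, commutatorElement_def, mul_inv_rev, mul_assoc a m k, h.eq]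
  group

theorem commutator_mul_mul_eq {a b m n : Γ} (hmb : Commute m b) (hmn : Commute m n)
    (han : Commute a n) : ⁅a * m, b * n⁆ = ⁅a, b⁆ := by
  rw [commutator_mul_left_eq (hmb.mul_right hmn), ← inv_inj, commutatorElement_inv,
    commutatorElement_inv, commutator_mul_left_eq han.symm]

end Group

variable {V : Type*} {T : SimpleGraph V} {d : ℕ} (c : Coloring T d)
  {F : Subgroup (Equiv.Perm (Fin d))}

theorem disjoint_branch_map (g : T ≃g T) {v w v' w' : V} :
    Disjoint (branch T (g v) (g w)) (branch T (g v') (g w')) ↔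
      Disjoint (branch T v w) (branch T v' w') := by
  rw [← image_branch, ← image_branch, Set.disjoint_image_iff g.injective]

theorem disjoint_branch_inv {g : T ≃g T} {v w : V}
    (h : Disjoint (branch T (g v) (g w)) (branch T v w)) :
    Disjoint (branch T (g⁻¹ v) (g⁻¹ w)) (branch T v w) := by
  rw [← disjoint_branch_map g, RelIso.apply_inv_self, RelIso.apply_inv_self]
  exact h.symm

/-- The double commutator trick: if `k` and `l` move the half-tree supporting `a` and `b` off itself
and to disjoint places, then `⁅⁅a, k⁆, ⁅b, l⁆⁆ = ⁅a, b⁆`. -/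
theorem commutator_mem_of_disjoint {H : Subgroup (T ≃g T)} {v w : V} {a b k l : T ≃g T}
    (ha : a ∈ rigid c F (branch T v w)) (hb : b ∈ rigid c F (branch T v w))
    (hk : k ∈ universalGroup c F) (hl : l ∈ universalGroup c F)
    (hak : ⁅a, k⁆ ∈ H) (hbl : ⁅b, l⁆ ∈ H)
    (h₁ : Disjoint (branch T (k v) (k w)) (branch T v w))
    (h₂ : Disjoint (branch T (l v) (l w)) (branch T v w))
    (h₃ : Disjoint (branch T (k v) (k w)) (branch T (l v) (l w))) : ⁅a, b⁆ ∈ H := by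
  have hm := conj_mem_rigid_branch c hk (inv_mem ha)
  have hn := conj_mem_rigid_branch c hl (inv_mem hb)
  have h4 : ⁅a, k⁆ = a * (k * a⁻¹ * k⁻¹) := by rw [commutatorElement_def]; group
  have h5 : ⁅b, l⁆ = b * (l * b⁻¹ * l⁻¹) := by rw [commutatorElement_def]; group
  have h6 : ⁅⁅a, k⁆, ⁅b, l⁆⁆ = ⁅a, b⁆ := by
    rw [h4, h5]
    exact commutator_mul_mul_eq (commute_of_disjoint c h₁ hm hb) (commute_of_disjoint c h₃ hm hn)
      (commute_of_disjoint c h₂ hn ha).symm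
  rw [← h6]
  exact mul_mem (mul_mem (mul_mem hak hbl) (inv_mem hak)) (inv_mem hbl)

section Tree

variable (hT : T.IsTree)
include hT

/-- If a half-tree has infinitely many pairwise disjoint translates under `H`, then `H` contains
all commutators in its group. -/
theorem commutator_mem_of_disjoint_translates {H : Subgroup (T ≃g T)}
    (hHU : H ≤ universalGroup c F) (hH : Commensurates (universalGroupPlus c F) H) {v w : V}
    (h : T.Adj v w) {s : ℕ → (T ≃g T)} (hs : ∀ n, s n ∈ H)
    (hdis : Pairwise fun i j =>
      Disjoint (branch T (s i v) (s i w)) (branch T (s j v) (s j w)))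
    {a b : T ≃g T} (ha : a ∈ rigid c F (branch T v w)) (hb : b ∈ rigid c F (branch T v w)) :
    ⁅a, b⁆ ∈ H := by
  have pairs : ∀ a ∈ rigid c F (branch T v w), ∃ k₁ ∈ H, ∃ k₂ ∈ H, ⁅a, k₁⁆ ∈ H ∧ ⁅a, k₂⁆ ∈ H ∧
      Disjoint (branch T (k₁ v) (k₁ w)) (branch T v w) ∧
      Disjoint (branch T (k₂ v) (k₂ w)) (branch T v w) ∧
      Disjoint (branch T (k₁ v) (k₁ w)) (branch T (k₂ v) (k₂ w)) := by
    intro a ha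
    obtain ⟨J, hJ, hJa⟩ := hH.exists_infinite (rigid_le_plus c hT h ha) hs
    obtain ⟨i, hi⟩ := hJ.nonempty
    obtain ⟨j, hj, hji⟩ := (hJ.sdiff (Set.finite_singleton i)).nonempty
    obtain ⟨k, hk, hkj⟩ := (hJ.sdiff (Set.toFinite {i, j})).nonempty
    simp only [Set.mem_singleton_iff, Set.mem_insert_iff, not_or] at hji hkj
    refine ⟨_, mul_mem (inv_mem (hs i)) (hs j), _, mul_mem (inv_mem (hs i)) (hs k),
      hJa i hi j hj, hJa i hi k hk, ?_, ?_, ?_⟩ <;>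
    · rw [← disjoint_branch_map (s i)]
      simp only [RelIso.mul_apply, RelIso.apply_inv_self]
      first | exact hdis hji | exact hdis hkj.1 | exact hdis (Ne.symm hkj.2)
  obtain ⟨k₁, hk₁, k₂, hk₂, e1, e2, e3, e4, e5⟩ := pairs a ha
  obtain ⟨l₁, hl₁, l₂, hl₂, f1, f2, f3, f4, f5⟩ := pairs b hb
  -- a translate for `a` and a translate for `b` are disjoint, as half-trees are nested or disjoint
  rcases branch_trichotomy hT (adj_map k₁ h) (adj_map l₁ h) with hd | hd | hd | hd
  · exact commutator_mem_of_disjoint c ha hb (hHU hk₁) (hHU hl₁) e1 f1 e3 f3 hd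
  · exact commutator_mem_of_disjoint c ha hb (hHU hk₂) (hHU hl₁) e2 f1 e4 f3
      (e5.mono_left hd).symm
  · exact commutator_mem_of_disjoint c ha hb (hHU hk₁) (hHU hl₂) e1 f2 e3 f4
      (f5.mono_left hd)
  · rcases hd w with hw | hw
    · exact absurd (mem_branch_right h) (Set.disjoint_left.1 e3 hw)
    · exact absurd (mem_branch_right h) (Set.disjoint_left.1 f3 hw)

/-- If the orbit of `v` under `H` is infinite, then some half-tree at `v` has infinitely many
pairwise disjoint translates. -/
theorem exists_disjoint_translates (c : Coloring T d) (hd : 3 ≤ d) {H : Subgroup (T ≃g T)} {v : V}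
    (hv : {x | ∃ g ∈ H, g v = x}.Infinite) :
    ∃ w, T.Adj v w ∧ ∃ s : ℕ → (T ≃g T), (∀ n, s n ∈ H) ∧ Pairwise fun i j =>
      Disjoint (branch T (s i v) (s i w)) (branch T (s j v) (s j w)) := by
  have hmem : ∀ n, ∃ g ∈ H, g v = hv.natEmbedding _ n := fun n => (hv.natEmbedding _ n).2
  choose s hs hsv using hmem
  have hinj : ∀ i j, s i v = s j v → i = j := by
    intro i j hij
    rw [hsv, hsv] at hij
    exact (hv.natEmbedding _).injective (Subtype.ext hij)
  let 𝒰 : Ultrafilter ℕ := hyperfilter ℕ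
  have hcof : ∀ i : ℕ, ∀ᶠ j in (𝒰 : Filter ℕ), j ≠ i := fun i =>
    Filter.Eventually.filter_mono hyperfilter_le_cofinite
      (Set.finite_singleton i).compl_mem_cofinite
  have pick : ∀ P : ℕ → Fin d → Prop, (∀ᶠ j in (𝒰 : Filter ℕ), ∃ k, P j k) →
      ∃ k, ∀ᶠ j in (𝒰 : Filter ℕ), P j k := by
    intro P hP
    by_contra hno
    push Not at hno
    have h1 : ∀ᶠ j in (𝒰 : Filter ℕ), ∀ k, ¬ P j k :=
      eventually_all.2 fun k => hno k
    obtain ⟨j, hj, k, hk⟩ := (h1.and hP).exists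
    exact hj k hk
  have hdir : ∀ i j, j ≠ i → ∃ k, (s i)⁻¹ (s j v) ∈ branch T v (c.nb v k) := by
    intro i j hji
    obtain ⟨w, hw, hx⟩ := exists_mem_branch hT (v := v) (x := (s i)⁻¹ (s j v)) (fun e =>
      hji (hinj j i (by rw [← e, RelIso.apply_inv_self, e])))
    exact ⟨c.col hw, by rwa [nb_col]⟩
  have hp : ∀ i, ∃ k, ∀ᶠ j in (𝒰 : Filter ℕ), (s i)⁻¹ (s j v) ∈ branch T v (c.nb v k) := fun i =>
    pick _ ((hcof i).mono fun j hj => hdir i j hj)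
  have hq : ∀ i, ∃ k, ∀ᶠ j in (𝒰 : Filter ℕ), (s j)⁻¹ (s i v) ∈ branch T v (c.nb v k) := fun i =>
    pick _ ((hcof i).mono fun j hj => hdir j i hj.symm)
  choose p hp using hp
  choose q hq using hq
  obtain ⟨P, hP⟩ := pick (fun i k => p i = k) (Eventually.of_forall fun i => ⟨_, rfl⟩)
  obtain ⟨Q, hQ⟩ := pick (fun i k => q i = k) (Eventually.of_forall fun i => ⟨_, rfl⟩)
  obtain ⟨w, hw, hwP, hwQ⟩ := exists_adj_ne c hd v (c.nb v P) (c.nb v Q)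
  have hnot : ∀ {x k}, x ∈ branch T v (c.nb v k) → w ≠ c.nb v k → x ∉ branch T v w :=
    fun hx hne => Set.disjoint_left.1 (branch_disjoint_of_ne hT (adj_nb c v _) hw hne.symm) hx
  obtain ⟨f, hf, hr⟩ := exists_seq_of_forall_finset_exists (fun i => p i = P ∧ q i = Q)
    (fun i j => (s i)⁻¹ (s j v) ∉ branch T v w ∧ (s j)⁻¹ (s i v) ∉ branch T v w ∧ j ≠ i)
    (fun S hS => by
      have h1 : ∀ᶠ j in (𝒰 : Filter ℕ), ∀ i ∈ S, (s i)⁻¹ (s j v) ∉ branch T v w ∧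
          (s j)⁻¹ (s i v) ∉ branch T v w ∧ j ≠ i := by
        refine (Finset.eventually_all S).2 fun i hi => ?_
        obtain ⟨hi1, hi2⟩ := hS i hi
        filter_upwards [hp i, hq i, hcof i] with j hj1 hj2 hj3
        rw [hi1] at hj1
        rw [hi2] at hj2
        exact ⟨hnot hj1 hwP, hnot hj2 hwQ, hj3⟩
      obtain ⟨j, ⟨hj1, hj2⟩, hj3⟩ := ((hP.and hQ).and h1).exists
      exact ⟨j, ⟨hj1, hj2⟩, hj3⟩)
  have hlt : ∀ i j, i < j → Disjoint (branch T (s (f i) v) (s (f i) w))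
      (branch T (s (f j) v) (s (f j) w)) := by
    intro i j hij
    obtain ⟨h1, h2, h3⟩ := hr i j hij
    refine branch_disjoint hT (adj_map _ hw) (adj_map _ hw) ?_ ?_ (Or.inl fun e => ?_)
    · rwa [mem_branch_map_iff]
    · rwa [mem_branch_map_iff]
    · exact h3 (hinj _ _ e).symm
  refine ⟨w, hw, fun n => s (f n), fun n => hs _, fun i j hij => ?_⟩
  rcases lt_or_gt_of_ne hij with h | h
  · exact hlt i j h
  · exact (hlt j i h).symm

/-- If `H` meets the group of every half-tree nontrivially, then it contains all commutators in
the group of some half-tree. -/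
theorem exists_commutator_mem_of_nontrivial (hd : 3 ≤ d) {H : Subgroup (T ≃g T)}
    (hH : Commensurates (universalGroupPlus c F) H)
    (hnt : ∀ v w, T.Adj v w → ∃ h ∈ H, h ∈ rigid c F (branch T v w) ∧ h ≠ 1) :
    ∃ v w, T.Adj v w ∧ ∀ a ∈ rigid c F (branch T v w), ∀ b ∈ rigid c F (branch T v w),
      ⁅a, b⁆ ∈ H := by
  obtain ⟨v⟩ := hT.connected.nonempty
  obtain ⟨w, hvw, -, -⟩ := exists_adj_ne c hd v v v
  obtain ⟨p, y, hadj, hdis, hsub⟩ := exists_disjoint_branches hT c hd hvw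
  choose h hhH hhZ hh1 using fun k => hnt _ _ (hadj k)
  choose p' y' hadj' hsub' hmove using fun k => exists_moved_branch c hT (hadj k) (hhZ k) (hh1 k)
  have hdis' : Pairwise fun k l =>
      Disjoint (branch T (p' k) (y' k)) (branch T (p' l) (y' l)) :=
    fun k l hkl => (hdis hkl).mono (hsub' k) (hsub' l)
  -- a diagonal argument over the infinitely many half-trees
  have claim : ∃ k, ∀ a ∈ rigid c F (branch T (p' k) (y' k)),
      ∃ e ∈ rigid c F (branch T (p k) (y k))ᶜ, ⁅a, (h k)⁻¹⁆ * e ∈ H := by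
    by_contra hno
    push Not at hno
    choose a ha hbad using hno
    obtain ⟨g, hg, hga⟩ := exists_glue c hT p' y' hadj' hdis' a ha
    have hgG : g ∈ universalGroupPlus c F := rigid_le_plus c hT hvw
      (rigid_mono c (Set.iUnion_subset fun k => (hsub' k).trans (hsub k)) hg)
    obtain ⟨J, hJ, hJg⟩ := hH.exists_infinite hgG hhH
    obtain ⟨i, hi⟩ := hJ.nonempty
    obtain ⟨j, hj, hji⟩ := (hJ.sdiff (Set.finite_singleton i)).nonempty
    have hji : j ≠ i := hji
    have hai : a i ∈ rigid c F (branch T (p i) (y i)) := rigid_mono c (hsub' i) (ha i)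
    have hm : (a i)⁻¹ * g ∈ rigid c F (branch T (p i) (y i))ᶜ := by
      refine ⟨mul_mem (inv_mem (ha i).1) hg.1, fun x hx => ?_⟩
      rw [Set.notMem_compl_iff] at hx
      rw [RelIso.mul_apply]
      by_cases hxi : x ∈ branch T (p' i) (y' i)
      · rw [hga i x hxi, RelIso.inv_apply_self]
      · have hgx : g x = x := hg.2 x (by
          rw [Set.mem_iUnion]
          rintro ⟨l, hl⟩
          by_cases hil : i = l
          · exact hxi (hil ▸ hl)
          · exact Set.disjoint_left.1 (hdis hil) hx (hsub' l hl))
        rw [hgx]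
        exact (inv_mem (ha i)).2 x hxi
    have hhj : h j ∈ rigid c F (branch T (p i) (y i))ᶜ :=
      rigid_mono c (Set.subset_compl_iff_disjoint_right.2 (hdis hji)) (hhZ j)
    have hcm : ∀ x ∈ rigid c F (branch T (p i) (y i)), ∀ z ∈ rigid c F (branch T (p i) (y i))ᶜ,
        Commute x z := fun x hx z hz => commute_of_disjoint c disjoint_compl_right hx hz
    refine hbad i ⁅(a i)⁻¹ * g, h j⁆ (mul_mem (mul_mem (mul_mem hm hhj) (inv_mem hm))
      (inv_mem hhj)) ?_
    rw [← commutator_mul_mul (hcm _ hai _ hm) (hcm _ hai _ hhj)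
      (hcm _ (inv_mem (hhZ i)) _ hm) (hcm _ (inv_mem (hhZ i)) _ hhj), mul_inv_cancel_left]
    exact hJg i hi j hj
  obtain ⟨k, hk⟩ := claim
  -- commutating once more with an element of `H` supported in the smaller half-tree
  have hnorm : ∀ a ∈ rigid c F (branch T (p' k) (y' k)), ∀ l ∈ H,
      l ∈ rigid c F (branch T (p' k) (y' k)) → ⁅a, l⁆ ∈ H := by
    intro a ha l hl hlX
    obtain ⟨e, he, heH⟩ := hk a ha
    have h1 : ⁅a, (h k)⁻¹⁆ * e = a * ((h k)⁻¹ * a⁻¹ * (h k)⁻¹⁻¹ * e) := by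
      rw [commutatorElement_def]; group
    have h2 : Commute e l := commute_of_disjoint c
      (disjoint_compl_left.mono_right (hsub' k)) he hlX
    have h3 : Commute ((h k)⁻¹ * a⁻¹ * (h k)⁻¹⁻¹) l := commute_of_disjoint c
      (disjoint_branch_inv (hmove k)) (conj_mem_rigid_branch c (inv_mem (hhZ k).1) (inv_mem ha))
      hlX
    rw [← commutator_mul_left_eq (h3.mul_left h2), ← h1]
    exact mul_mem (mul_mem (mul_mem heH hl) (inv_mem heH)) (inv_mem hl)
  obtain ⟨l, hlH, hlX, hl1⟩ := hnt _ _ (hadj' k)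
  obtain ⟨p₁, y₁, hadj₁, hsub₁, hmove₁⟩ := exists_moved_branch c hT (hadj' k) hlX hl1
  obtain ⟨l', hlH', hlX', hl1'⟩ := hnt _ _ hadj₁
  obtain ⟨p₂, y₂, hadj₂, hsub₂, hmove₂⟩ := exists_moved_branch c hT hadj₁ hlX' hl1'
  have hl₂ : branch T (l p₂) (l y₂) ⊆ branch T (l p₁) (l y₁) := by
    rw [← image_branch, ← image_branch]; exact Set.image_mono hsub₂
  have hl₂' : branch T (l' p₂) (l' y₂) ⊆ branch T p₁ y₁ := by
    rw [← image_branch]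
    rintro _ ⟨x, hx, rfl⟩
    exact map_mem_of_mem_rigid c hlX' (hsub₂ hx)
  refine ⟨p₂, y₂, hadj₂, fun a ha b hb => ?_⟩
  have hX : rigid c F (branch T p₂ y₂) ≤ rigid c F (branch T (p' k) (y' k)) :=
    rigid_mono c (hsub₂.trans hsub₁)
  exact commutator_mem_of_disjoint c ha hb hlX.1 hlX'.1 (hnorm a (hX ha) l hlH hlX)
    (hnorm b (hX hb) l' hlH' (rigid_mono c hsub₁ hlX')) (hmove₁.mono hl₂ hsub₂) hmove₂
    (hmove₁.mono hl₂ hl₂')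

end Tree

end

/-! ### Subgroups meeting the group of a half-tree trivially -/

section

open scoped commutatorElement

variable {V : Type*} {T : SimpleGraph V} {d : ℕ} (c : Coloring T d)
  {F : Subgroup (Equiv.Perm (Fin d))}

/-- `x` is a vertex of the half-tree at `w` away from `v` that is moved by `h` and has minimal
depth with this property; `p` is its parent. -/
structure IsFirstMoved (v w : V) (h : T ≃g T) (p x : V) : Prop where
  adj : T.Adj p x
  dist_eq : T.dist v x = T.dist v p + 1
  parent_mem : p ∈ branch T v w
  mem : x ∈ branch T v w
  left : h v = v
  right : h w = w
  moved : h x ≠ x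
  fixed : ∀ y ∈ branch T v w, T.dist v y < T.dist v x → h y = y

theorem IsFirstMoved.map {v w p x : V} {h : T ≃g T} (hx : IsFirstMoved v w h p x) :
    IsFirstMoved v w h p (h x) := by
  have hp : h p = p := hx.fixed p hx.parent_mem (by have := hx.dist_eq; omega)
  have hd : T.dist v (h x) = T.dist v x := by
    conv_lhs => rw [← hx.left]
    exact dist_map h v x
  refine ⟨?_, by rw [hd, hx.dist_eq], hx.parent_mem, ?_, hx.left, hx.right,
    fun e => hx.moved (h.injective e), fun y hy hlt => hx.fixed y hy (by rwa [hd] at hlt)⟩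
  · have := adj_map h hx.adj
    rwa [hp] at this
  · have := (map_mem_branch_iff h).2 hx.mem
    rwa [hx.left, hx.right] at this

section Tree

variable (hT : T.IsTree)
include hT

theorem exists_isFirstMoved {v w : V} (hvw : T.Adj v w) {h : T ≃g T} (hv : h v = v) (hw : h w = w)
    {x : V} (hx : x ∈ branch T v w) (hhx : h x ≠ x) : ∃ p x, IsFirstMoved v w h p x := by
  obtain ⟨x, ⟨hx, hhx⟩, hmin⟩ := (measure fun x => T.dist v x).wf.has_min
    {x | x ∈ branch T v w ∧ h x ≠ x} ⟨x, hx, hhx⟩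
  obtain ⟨p, hp, hd⟩ := exists_parent hT (v := v) (x := x)
    (by rintro rfl; exact not_mem_branch_left hx)
  refine ⟨p, x, hp.symm, hd, ?_, hx, hv, hw, hhx, fun y hy hlt => ?_⟩
  · by_contra hpb
    rw [(eq_of_adj_of_mem_branch hT hvw hp hx hpb).1] at hhx
    exact hhx hw
  · by_contra hhy
    exact hmin y ⟨hy, hhy⟩ hlt

theorem branch_subset_of_deeper {v p x p' x' : V} (h : T.Adj p x)
    (hd : T.dist v x = T.dist v p + 1) (h' : T.Adj p' x') (hd' : T.dist v x' = T.dist v p' + 1)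
    (hlt : T.dist v x < T.dist v x') (hmem : x' ∈ branch T p x) :
    branch T p' x' ⊆ branch T p x := by
  refine branch_subset hT h h' (fun hp => ?_) ?_
  · have := dist_le_of_mem_branch hT h' hd' hp
    omega
  · by_contra hp
    rw [(eq_of_adj_of_mem_branch hT h h'.symm hmem hp).1] at hlt
    omega

theorem branch_disjoint_of_deeper {v p x p' x' : V} (h : T.Adj p x)
    (hd : T.dist v x = T.dist v p + 1) (h' : T.Adj p' x') (hd' : T.dist v x' = T.dist v p' + 1)
    (hlt : T.dist v x < T.dist v x') (hmem : x' ∉ branch T p x) :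
    Disjoint (branch T p x) (branch T p' x') := by
  refine branch_disjoint hT h h' (fun hp => ?_) (fun hp => ?_)
    (Or.inr fun e => by rw [e] at hlt; omega)
  · have := dist_le_of_mem_branch hT h' hd' hp
    omega
  · obtain ⟨-, e⟩ := eq_of_adj_of_mem_branch hT h h' hp hmem
    rw [e] at hlt
    omega

/-- A sequence of first moved vertices of increasing depth can be refined so that the half-trees
at these vertices are pairwise disjoint. -/
theorem exists_disjoint_isFirstMoved {v w : V} {h : ℕ → (T ≃g T)} {p x : ℕ → V}
    (hx : ∀ n, IsFirstMoved v w (h n) (p n) (x n))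
    (hlt : ∀ m n, m < n → T.dist v (x m) + 1 < T.dist v (x n)) :
    ∃ (f : ℕ → ℕ) (y : ℕ → V), StrictMono f ∧
      (∀ n, IsFirstMoved v w (h (f n)) (p (f n)) (y n)) ∧
      (∀ m n, m < n → T.dist v (y m) + 1 < T.dist v (y n)) ∧
      ∀ m n, m < n → Disjoint (branch T (p (f m)) (y m)) (branch T (p (f n)) (y n)) := by
  obtain ⟨f, hf | hf⟩ := exists_increasing_or_nonincreasing_subseq'
    (fun a b : V × V => b.2 ∈ branch T a.1 a.2) fun n => (p n, x n)
  · -- a chain: replace each vertex by its image, which is a sibling off the chain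
    have hsub : ∀ m n, m ≤ n →
        branch T (p (f n)) (x (f n)) ⊆ branch T (p (f m)) (x (f m)) := by
      intro m n hmn
      induction n, hmn using Nat.le_induction with
      | base => exact subset_rfl
      | succ n _ ih =>
        refine (branch_subset_of_deeper hT (hx _).adj (hx _).dist_eq (hx _).adj (hx _).dist_eq
          ?_ (hf n)).trans ih
        have := hlt _ _ (f.strictMono (Nat.lt_add_one n))
        omega
    have hdist : ∀ n, T.dist v (h n (x n)) = T.dist v (x n) := by
      intro n
      conv_lhs => rw [← (hx n).left]
      exact dist_map _ _ _
    refine ⟨f, fun n => h (f n) (x (f n)), f.strictMono, fun n => (hx _).map,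
      fun m n hmn => ?_, fun m n hmn => ?_⟩
    · dsimp only
      rw [hdist, hdist]
      exact hlt _ _ (f.strictMono hmn)
    · have hy := fun k => (hx k).map
      have hl := hlt _ _ (f.strictMono hmn)
      refine branch_disjoint_of_deeper hT (hy _).adj (hy _).dist_eq (hy _).adj (hy _).dist_eq
        (by rw [hdist, hdist]; omega) fun hmem => ?_
      have h1 : h (f n) (p (f m)) = p (f m) := (hx _).fixed _ (hx _).parent_mem
        (by have := (hx (f m)).dist_eq; omega)
      have h2 : h (f n) (h (f m) (x (f m))) = h (f m) (x (f m)) := (hx _).fixed _ (hy _).mem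
        (by rw [hdist]; omega)
      have h3 : x (f n) ∈ branch T (p (f m)) (h (f m) (x (f m))) := by
        rw [← map_mem_branch_iff (h (f n)), h1, h2]
        exact hmem
      exact Set.disjoint_left.1 (branch_disjoint_of_ne hT (hy (f m)).adj (hx (f m)).adj
        (hx (f m)).moved) h3 (hsub m n hmn.le (mem_branch_right (hx _).adj))
  · refine ⟨f, fun n => x (f n), f.strictMono, fun n => hx _,
      fun m n hmn => hlt _ _ (f.strictMono hmn), fun m n hmn => ?_⟩
    have hl := hlt _ _ (f.strictMono hmn)
    exact branch_disjoint_of_deeper hT (hx _).adj (hx _).dist_eq (hx _).adj (hx _).dist_eq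
      (by dsimp only; omega) (hf m n hmn)

/-- There is an element supported in the half-tree at `w` that commutes with no quotient of two
of the given elements. -/
theorem exists_not_commute (hF : IsTwoTransitive F) (hd : 3 ≤ d) {v w : V} (hvw : T.Adj v w)
    {h : ℕ → (T ≃g T)} {p x : ℕ → V}
    (hx : ∀ n, IsFirstMoved v w (h n) (p n) (x n))
    (hlt : ∀ m n, m < n → T.dist v (x m) + 1 < T.dist v (x n))
    (hdis : ∀ m n, m < n → Disjoint (branch T (p m) (x m)) (branch T (p n) (x n))) :
    ∃ a ∈ rigid c F (branch T v w), ∀ i j, i < j → ¬ Commute a ((h i)⁻¹ * h j) := by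
  have hdis' : Pairwise fun m n => Disjoint (branch T (p m) (x m)) (branch T (p n) (x n)) := by
    intro m n hmn
    rcases lt_or_gt_of_ne hmn with h | h
    · exact hdis m n h
    · exact (hdis n m h).symm
  have hchild : ∀ n, ∃ u, T.Adj (x n) u ∧ u ≠ p n ∧
      ∃ a ∈ rigid c F (branch T (p n) (x n)), a u ≠ u := by
    intro n
    obtain ⟨u, hu, hup, -⟩ := exists_adj_ne c hd (x n) (p n) (p n)
    obtain ⟨u', hu', hup', huu⟩ := exists_adj_ne c hd (x n) (p n) u
    obtain ⟨a, ha, hau⟩ := exists_rigid_map_adj c hT hF (hx n).adj hu hu' hup hup'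
    exact ⟨u, hu, hup, a, ha, by rw [hau]; exact huu⟩
  choose u hu hup a ha hau using hchild
  have hsub : ∀ n, branch T (p n) (x n) ⊆ branch T v w := fun n =>
    branch_subset_of_mem hT hvw (hx n).adj (hx n).dist_eq (hx n).mem
      (mem_branch_right (hx n).adj)
  have hux : ∀ n, u n ∈ branch T (p n) (x n) := by
    intro n
    by_contra hn
    exact hup n (eq_of_adj_of_mem_branch hT (hx n).adj (hu n) (mem_branch_right (hx n).adj) hn).2
  obtain ⟨g, hg, hga⟩ := exists_glue c hT p x (fun n => (hx n).adj) hdis' a ha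
  refine ⟨g, rigid_mono c (Set.iUnion_subset hsub) hg, fun i j hij hcomm => ?_⟩
  have hdu : T.dist v (u i) = T.dist v (x i) + 1 := by
    have h1 := dist_lt_of_mem_branch hT (hx i).adj (hx i).dist_eq (hux i) (hu i).ne'
    have h2 := hT.dist_eq_dist_add_one_of_adj v (hu i)
    omega
  have hju : h j (u i) = u i := (hx j).fixed _ (hsub i (hux i)) (by
    have := hlt i j hij; omega)
  -- the image of the child `u i` is moved by `g`
  have hmoved : g ((h i)⁻¹ (u i)) ≠ (h i)⁻¹ (u i) := by
    have h1 := DFunLike.congr_fun hcomm.eq (u i)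
    simp only [RelIso.mul_apply] at h1
    rw [hju] at h1
    rw [h1, hga i _ (hux i)]
    intro h2
    have h3 := (h i)⁻¹.injective h2
    have h4 : h j (a i (u i)) = h j (u i) := by rw [h3, hju]
    exact hau i ((h j).injective h4)
  obtain ⟨k, hk⟩ : ∃ k, (h i)⁻¹ (u i) ∈ branch T (p k) (x k) := by
    by_contra hno
    push Not at hno
    exact hmoved (hg.2 _ (by simpa using hno))
  -- so the image of `x i` lies in one of the half-trees
  have hy : (h i)⁻¹ (x i) ∈ branch T (p k) (x k) := by
    by_contra hy
    have h1 := (eq_of_adj_of_mem_branch hT (hx k).adj (adj_map (h i)⁻¹ (hu i)).symm hk hy).1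
    rw [hga k _ hk, h1, fixes_right c hT (hx k).adj (ha k)] at hmoved
    exact hmoved rfl
  have hdy : T.dist v ((h i)⁻¹ (x i)) = T.dist v (x i) := by
    rw [← dist_map (h i), RelIso.apply_inv_self, (hx i).left]
  rcases lt_trichotomy k i with hki | rfl | hik
  · have h1 : h i (p k) = p k := (hx i).fixed _ (hx k).parent_mem
      (by have := (hx k).dist_eq; have := hlt k i hki; omega)
    have h2 : h i (x k) = x k := (hx i).fixed _ (hx k).mem (by have := hlt k i hki; omega)
    rw [← mem_branch_map_iff, h1, h2] at hy
    exact Set.disjoint_left.1 (hdis k i hki) hy (mem_branch_right (hx i).adj)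
  · by_cases hne : (h k)⁻¹ (x k) = x k
    · refine (hx k).moved ?_
      conv_lhs => rw [← hne]
      exact RelIso.apply_inv_self _ _
    · have := dist_lt_of_mem_branch hT (hx k).adj (hx k).dist_eq hy hne
      omega
  · have h1 := dist_le_of_mem_branch hT (hx k).adj (hx k).dist_eq hy
    have := hlt i k hik
    omega

/-- If `H` meets the group of one half-tree trivially, then it meets the group of every half-tree
in a finite group. -/
theorem finite_inter_rigid (hF : IsTwoTransitive F) (hd : 3 ≤ d)
    (hgen : ∀ K : Subgroup (Equiv.Perm (Fin d)), (∀ σ ∈ F, ∀ i, σ i = i → σ ∈ K) → F ≤ K)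
    {H : Subgroup (T ≃g T)} (hH : Commensurates (universalGroupPlus c F) H) {v₀ w₀ : V}
    (h₀ : T.Adj v₀ w₀) (htriv : ∀ h ∈ H, h ∈ rigid c F (branch T v₀ w₀) → h = 1) {v w : V}
    (h : T.Adj v w) : {g | g ∈ H ∧ g ∈ rigid c F (branch T v w)}.Finite := by
  obtain ⟨g, hg, hgsub⟩ := exists_branch_subset c hT hF hd hgen h₀ h
  obtain ⟨K, -, hK, hKg⟩ := hH g hg
  by_contra hinf
  have hinf : {g | g ∈ H ∧ g ∈ rigid c F (branch T v w)}.Infinite := hinf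
  obtain ⟨J, hJ, hJs⟩ := exists_infinite_of_relIndex hK
    (s := fun n => (hinf.natEmbedding _ n : T ≃g T)) (fun n => (hinf.natEmbedding _ n).2.1)
  obtain ⟨i, hi⟩ := hJ.nonempty
  obtain ⟨j, hj, hji⟩ := (hJ.sdiff (Set.finite_singleton i)).nonempty
  have hk := hJs i hi j hj
  have h1 := htriv _ (hKg _ hk) (rigid_mono c hgsub (conj_mem_rigid_branch c (plus_le c hg)
    (mul_mem (inv_mem (hinf.natEmbedding _ i).2.2) (hinf.natEmbedding _ j).2.2)))
  have h2 := conj_eq_one_iff.1 h1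
  refine hji ((hinf.natEmbedding _).injective (Subtype.ext ?_)).symm
  exact inv_mul_eq_one.1 h2

/-- A commensurated subgroup with finite orbits that meets the group of some half-tree trivially
is finite. -/
theorem finite_of_inter_rigid_trivial (hF : IsTwoTransitive F) (hd : 3 ≤ d)
    (hgen : ∀ K : Subgroup (Equiv.Perm (Fin d)), (∀ σ ∈ F, ∀ i, σ i = i → σ ∈ K) → F ≤ K)
    {H : Subgroup (T ≃g T)} (hHU : H ≤ universalGroup c F)
    (hH : Commensurates (universalGroupPlus c F) H)
    (hbdd : ∀ v, {x | ∃ g ∈ H, g v = x}.Finite) {v₀ w₀ : V}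
    (h₀ : T.Adj v₀ w₀) (htriv : ∀ h ∈ H, h ∈ rigid c F (branch T v₀ w₀) → h = 1) :
    (H : Set (T ≃g T)).Finite := by
  by_contra hinf
  have hinf : (H : Set (T ≃g T)).Infinite := hinf
  -- pointwise stabilizers of finite sets in `H` are nontrivial
  have hfix : ∀ B : Set V, B.Finite → ∃ g ∈ H, g ≠ 1 ∧ ∀ x ∈ B, g x = x := by
    intro B hB
    have := hB.to_subtype
    obtain ⟨g, hg, g', hg', hne, he⟩ := hinf.exists_ne_map_eq_of_mapsTo
      (f := fun g (x : B) => g x) (t := Set.pi Set.univ fun x : B => {y | ∃ g ∈ H, g x = y})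
      (fun g hg x _ => ⟨g, hg, rfl⟩) (Set.Finite.pi fun x => hbdd x)
    refine ⟨g⁻¹ * g', mul_mem (inv_mem hg) hg', fun e => hne (inv_mul_eq_one.1 e), fun x hx => ?_⟩
    have h1 : g x = g' x := congrFun he ⟨x, hx⟩
    rw [RelIso.mul_apply, ← h1, RelIso.inv_apply_self]
  obtain ⟨w, hvw, hw⟩ : ∃ w, T.Adj v₀ w ∧ ∀ B : Set V, B.Finite →
      ∃ g ∈ H, (∀ x ∈ B, g x = x) ∧ ∃ x ∈ branch T v₀ w, g x ≠ x := by
    by_contra hno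
    push Not at hno
    choose B hB hBg using fun k => hno _ (adj_nb c v₀ k)
    obtain ⟨g, hg, hg1, hgB⟩ := hfix ({v₀} ∪ ⋃ k, B k)
      ((Set.finite_singleton v₀).union (Set.finite_iUnion hB))
    refine hg1 (RelIso.ext fun x => ?_)
    by_cases hx : x = v₀
    · exact hgB x (Or.inl hx)
    · obtain ⟨w, hw, hxw⟩ := exists_mem_branch hT hx
      rw [← nb_col c hw] at hxw
      exact hBg _ g hg (fun z hz => hgB z (Or.inr (Set.mem_iUnion.2 ⟨_, hz⟩))) x hxw
  obtain ⟨f, hf, hlt⟩ := exists_seq_of_forall_finset_exists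
    (fun z : (T ≃g T) × V × V => z.1 ∈ H ∧ IsFirstMoved v₀ w z.1 z.2.1 z.2.2)
    (fun z z' => T.dist v₀ z.2.2 + 1 < T.dist v₀ z'.2.2)
    (fun S _ => by
      let N := S.sup fun z => T.dist v₀ z.2.2 + 1
      obtain ⟨g, hg, hgB, x, hx, hgx⟩ := hw ({w} ∪ {x | T.dist v₀ x ≤ N})
        ((Set.finite_singleton w).union (finite_ball hT c v₀ N))
      have hgv : g v₀ = v₀ := hgB v₀ (Or.inr (by simp))
      obtain ⟨p, x, hpx⟩ := exists_isFirstMoved hT hvw hgv (hgB w (Or.inl rfl)) hx hgx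
      refine ⟨(g, p, x), ⟨hg, hpx⟩, fun z hz => ?_⟩
      have h1 : T.dist v₀ z.2.2 + 1 ≤ N :=
        Finset.le_sup (f := fun z : (T ≃g T) × V × V => T.dist v₀ z.2.2 + 1) hz
      have h2 : N < T.dist v₀ x := by
        by_contra hle
        exact hpx.moved (hgB x (Or.inr (not_lt.1 hle)))
      exact lt_of_le_of_lt h1 h2)
  obtain ⟨φ, y, hφ, hy, hylt, hydis⟩ := exists_disjoint_isFirstMoved hT
    (h := fun n => (f n).1) (p := fun n => (f n).2.1) (x := fun n => (f n).2.2)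
    (fun n => (hf n).2) hlt
  obtain ⟨a, ha, hac⟩ := exists_not_commute c hT hF hd hvw
    (h := fun n => (f (φ n)).1) (p := fun n => (f (φ n)).2.1) hy hylt hydis
  have hs : ∀ n, (f (φ n)).1 ∈ H := fun n => (hf _).1
  obtain ⟨J, hJ, hJa⟩ := hH.exists_infinite (rigid_le_plus c hT hvw ha) hs
  obtain ⟨i, hi⟩ := hJ.nonempty
  -- the commutators of `a` with quotients lie in a finite group, so two of them agree
  have hfin := finite_inter_rigid c hT hF hd hgen hH h₀ htriv hvw
  obtain ⟨j, hj, k, hk, hjk, he⟩ := hJ.exists_ne_map_eq_of_mapsTo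
    (t := {g | g ∈ H ∧ g ∈ rigid c F (branch T v₀ w)})
    (f := fun j => ⁅a, (f (φ i)).1⁻¹ * (f (φ j)).1⁆) (fun j hj => ⟨hJa i hi j hj, by
      have hg : (f (φ i)).1⁻¹ * (f (φ j)).1 ∈ universalGroup c F :=
        hHU (mul_mem (inv_mem (hs i)) (hs j))
      have h1 := conj_mem_rigid_branch c hg (inv_mem ha)
      have hinv : ∀ z, (f (φ i)).1 z = z → (f (φ i)).1⁻¹ z = z := fun z hz => by
        conv_lhs => rw [← hz]
        exact RelIso.inv_apply_self _ _
      rw [RelIso.mul_apply, RelIso.mul_apply, (hy j).left, (hy j).right, hinv _ (hy i).left,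
        hinv _ (hy i).right] at h1
      have h2 := mul_mem ha h1
      rwa [← mul_assoc, ← mul_assoc] at h2⟩) hfin
  have hcomm : Commute a ((f (φ j)).1⁻¹ * (f (φ k)).1) := by
    generalize (f (φ i)).1 = r at he
    generalize (f (φ j)).1 = s at he ⊢
    generalize (f (φ k)).1 = t at he ⊢
    have h1 : s * a⁻¹ * s⁻¹ = t * a⁻¹ * t⁻¹ := by
      have h2 : ∀ s : T ≃g T, ⁅a, r⁻¹ * s⁆ = a * r⁻¹ * (s * a⁻¹ * s⁻¹) * r := fun s => by
        rw [commutatorElement_def]; group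
      rw [h2, h2] at he
      exact mul_left_cancel (mul_right_cancel he)
    have h3 : Commute a⁻¹ (s⁻¹ * t) := by
      change a⁻¹ * (s⁻¹ * t) = s⁻¹ * t * a⁻¹
      calc a⁻¹ * (s⁻¹ * t) = s⁻¹ * (s * a⁻¹ * s⁻¹) * t := by group
        _ = s⁻¹ * (t * a⁻¹ * t⁻¹) * t := by rw [h1]
        _ = s⁻¹ * t * a⁻¹ := by group
    exact Commute.inv_left_iff.1 h3
  rcases lt_or_gt_of_ne hjk with hlt' | hlt'
  · exact hac j k hlt' hcomm
  · refine hac k j hlt' ?_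
    have := hcomm.inv_right
    rwa [mul_inv_rev, inv_inv] at this

end Tree

end

/-! ### Openness, compactness and the unbounded case -/

section

open Topology Filter
open scoped Pointwise commutatorElement

/-- Pigeonhole principle for a finite index subgroup `L` of `A`: some normal subgroup of `A` inside
`L` does not separate two of infinitely many given subgroups of `A`. -/
theorem exists_normal_pigeonhole {Γ : Type*} [Group Γ] {A L : Subgroup Γ} (hL : L.relIndex A ≠ 0)
    (B : ℕ → Subgroup Γ) (hB : ∀ k, B k ≤ A) :
    ∃ N ≤ L, (∀ a ∈ A, ∀ n ∈ N, a * n * a⁻¹ ∈ N) ∧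
      ∃ k l, k ≠ l ∧ ∀ a ∈ B k, ∃ b ∈ B l, b⁻¹ * a ∈ N := by
  have hfin : (L.subgroupOf A).FiniteIndex := ⟨hL⟩
  let M := (L.subgroupOf A).normalCore
  have hM : M ≤ L.subgroupOf A := Subgroup.normalCore_le _
  have hMn : M.Normal := Subgroup.normalCore_normal _
  have hMfin : M.FiniteIndex := Subgroup.finiteIndex_normalCore _
  refine ⟨M.map A.subtype, ?_, ?_, ?_⟩
  · rintro _ ⟨x, hx, rfl⟩
    exact hM hx
  · rintro a ha _ ⟨x, hx, rfl⟩
    exact ⟨_, hMn.conj_mem x hx ⟨a, ha⟩, rfl⟩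
  · obtain ⟨k, l, hkl, he⟩ := Finite.exists_ne_map_eq_of_infinite
      fun k => ((B k).subgroupOf A).map (QuotientGroup.mk' M)
    refine ⟨k, l, hkl, fun a ha => ?_⟩
    have h1 : QuotientGroup.mk' M ⟨a, hB k ha⟩ ∈
        ((B k).subgroupOf A).map (QuotientGroup.mk' M) := ⟨⟨a, hB k ha⟩, ha, rfl⟩
    rw [he] at h1
    obtain ⟨b, hb, hba⟩ := h1
    have h2 : b⁻¹ * ⟨a, hB k ha⟩ ∈ M := QuotientGroup.eq.1 hba
    exact ⟨b, hb, b⁻¹ * ⟨a, hB k ha⟩, h2, rfl⟩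

/-- If the commuting elements `b` and `b'` normalize `N`, then every element of `b N` commutes with
`b'` modulo `N`. -/
theorem commutator_mem_of_inv_mul_mem {Γ : Type*} [Group Γ] {N : Subgroup Γ} {a b b' : Γ}
    (ha : ∀ n ∈ N, b * n * b⁻¹ ∈ N) (hb' : ∀ n ∈ N, b' * n * b'⁻¹ ∈ N) (hc : Commute b b')
    (h : b⁻¹ * a ∈ N) : ⁅a, b'⁆ ∈ N := by
  have h1 : ⁅a, b'⁆ = b * ((b⁻¹ * a) * (b' * (b⁻¹ * a)⁻¹ * b'⁻¹)) * b⁻¹ := by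
    rw [show b * ((b⁻¹ * a) * (b' * (b⁻¹ * a)⁻¹ * b'⁻¹)) * b⁻¹ =
      a * b' * a⁻¹ * (b * b'⁻¹ * b⁻¹) by group, hc.inv_right.eq, mul_inv_cancel_right,
      commutatorElement_def]
  rw [h1]
  exact ha _ (mul_mem h (hb' _ (inv_mem h)))

variable {V : Type*} {T : SimpleGraph V} {d : ℕ} (c : Coloring T d)
  {F : Subgroup (Equiv.Perm (Fin d))}

section Tree

variable (hT : T.IsTree)
include hT

/-- If `H` contains the group of one half-tree, then in any half-tree it contains the groups of all
sufficiently deep half-trees. Indeed `H` contains a finite index subgroup of the group `A` of the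
given half-tree, hence a normal one `N`. By pigeonhole the groups of two disjoint half-trees have
the same image in `A / N`. As they commute, this image is abelian, hence trivial by perfectness. -/
theorem exists_depth_in_branch (hF : IsTwoTransitive F) (hd : 3 ≤ d)
    (hgen : ∀ K : Subgroup (Equiv.Perm (Fin d)), (∀ σ ∈ F, ∀ i, σ i = i → σ ∈ K) → F ≤ K)
    (hperf : ∀ i, ⁅pointStabilizer F i, pointStabilizer F i⁆ = pointStabilizer F i)
    {H : Subgroup (T ≃g T)} (hH : Commensurates (universalGroupPlus c F) H) {v₀ w₀ : V}
    (h₀ : T.Adj v₀ w₀) (hle : rigid c F (branch T v₀ w₀) ≤ H) {v w : V} (h : T.Adj v w) :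
    ∃ n, ∀ p y, T.Adj p y → T.dist v y = T.dist v p + 1 → y ∈ branch T v w → n ≤ T.dist v y →
      rigid c F (branch T p y) ≤ H := by
  obtain ⟨g, hg, hgsub⟩ := exists_branch_subset c hT hF hd hgen h₀ h
  obtain ⟨K, hKH, hK, hKg⟩ := hH g⁻¹ (inv_mem hg)
  set A := rigid c F (branch T v w) with hA
  -- `H` contains a finite index subgroup of `A`
  let L : Subgroup (T ≃g T) := K.comap (MulAut.conj g).toMonoidHom
  have hL : L.relIndex A ≠ 0 := by
    rw [Subgroup.relIndex_comap]
    refine fun h0 => hK (Subgroup.relIndex_eq_zero_of_le_right ?_ h0)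
    rintro _ ⟨a, ha, rfl⟩
    exact hle (rigid_mono c hgsub (conj_mem_rigid_branch c (plus_le c hg) ha))
  have hLH : L ≤ H := by
    intro a ha
    have h1 := hKg _ (show g * a * g⁻¹ ∈ K from ha)
    rwa [show g⁻¹ * (g * a * g⁻¹) * g⁻¹⁻¹ = a by group] at h1
  obtain ⟨p, y, hadj, hdis, hsub⟩ := exists_disjoint_branches hT c hd h
  obtain ⟨N, hNL, hNn, k, l, hkl, hNkl⟩ := exists_normal_pigeonhole hL
    (fun k => rigid c F (branch T (p k) (y k))) fun k => rigid_mono c (hsub k)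
  have hN : rigid c F (branch T (p k) (y k)) ≤ N :=
    rigid_branch_le_of_commutators c hT hF hd hperf (hadj k) fun a ha b hb => by
      obtain ⟨a', ha', haa'⟩ := hNkl a ha
      exact commutator_mem_of_inv_mul_mem (hNn a' (rigid_mono c (hsub l) ha'))
        (hNn b (rigid_mono c (hsub k) hb)) (commute_of_disjoint c (hdis hkl.symm) ha' hb) haa'
  have hdk : T.dist v (y k) = T.dist v (p k) + 1 := by
    have h1 : v ∉ branch T (p k) (y k) := fun hv => not_mem_branch_left (hsub k hv)
    exact dist_of_not_mem_branch hT (hadj k) h1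
  -- by transitivity, the same holds at all half-trees of the same depth
  have hsame : ∀ q z, T.Adj q z → T.dist v z = T.dist v q + 1 → z ∈ branch T v w →
      T.dist v z = T.dist v (y k) → rigid c F (branch T q z) ≤ H := by
    intro q z hqz hdz hz hdzk b hb
    obtain ⟨a, ha, haz⟩ := exists_rigid_map_depth c hT hF h hz
      (hsub k (mem_branch_right (hadj k))) hdzk
    have hda : ∀ x, T.dist v (a x) = T.dist v x := by
      intro x
      conv_lhs => rw [← fixes_left c ha]
      exact dist_map a v x
    have haq : a q = p k := by
      have h1 := adj_map a hqz.symm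
      rw [haz] at h1
      exact parent_unique hT (v := v) h1 (hadj k).symm (by rw [hda]; omega) (by omega)
    have h1 := conj_mem_rigid_branch c ha.1 hb
    rw [haq, haz] at h1
    have h2 := hNn a⁻¹ (inv_mem ha) _ (hN h1)
    rw [show a⁻¹ * (a * b * a⁻¹) * a⁻¹⁻¹ = b by group] at h2
    exact hLH (hNL h2)
  refine ⟨T.dist v (y k), fun q z hqz hdz hz hle => ?_⟩
  obtain ⟨q', z', hqz', h1, h2, h3⟩ := exists_ancestor hT (v := v) (x := z)
    (n := T.dist v (y k)) (by omega) hle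
  have hd' : T.dist v z' = T.dist v q' + 1 := by omega
  have hzsub := branch_subset_of_mem hT h hqz' hd' hz h3
  rcases hle.eq_or_lt with he | hlt
  · exact hsame q z hqz hdz hz he.symm
  · exact (rigid_mono c (branch_subset_of_deeper hT hqz' hd' hqz hdz (h1.symm ▸ hlt) h3)).trans
      (hsame q' z' hqz' hd' (hzsub (mem_branch_right hqz')) h1)

/-- If `H` contains the group of one half-tree, then it contains the groups of all half-trees
pointing away from `v` and sufficiently far from it. -/
theorem exists_depth (hF : IsTwoTransitive F) (hd : 3 ≤ d)
    (hgen : ∀ K : Subgroup (Equiv.Perm (Fin d)), (∀ σ ∈ F, ∀ i, σ i = i → σ ∈ K) → F ≤ K)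
    (hperf : ∀ i, ⁅pointStabilizer F i, pointStabilizer F i⁆ = pointStabilizer F i)
    {H : Subgroup (T ≃g T)} (hH : Commensurates (universalGroupPlus c F) H) {v₀ w₀ : V}
    (h₀ : T.Adj v₀ w₀) (hle : rigid c F (branch T v₀ w₀) ≤ H) (v : V) :
    ∃ n, 1 ≤ n ∧ ∀ p y, T.Adj p y → T.dist v y = T.dist v p + 1 → n ≤ T.dist v y →
      rigid c F (branch T p y) ≤ H := by
  choose n hn using fun i =>
    exists_depth_in_branch c hT hF hd hgen hperf hH h₀ hle (adj_nb c v i)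
  refine ⟨Finset.univ.sup n + 1, by omega, fun p y hpy hdy hy => ?_⟩
  obtain ⟨w, hw, hyw⟩ := exists_mem_branch hT (v := v) (x := y) (by
    rintro rfl
    simp at hdy)
  refine hn (c.col hw) p y hpy hdy (by rwa [nb_col]) ?_
  have := Finset.le_sup (f := n) (Finset.mem_univ (c.col hw))
  omega

/-- If `H` contains the groups of all half-trees pointing away from `v` at distance `n`, then it
contains the pointwise stabilizer of the ball of radius `n`. -/
theorem mem_of_fixes_ball {H : Subgroup (T ≃g T)} {v : V} {n : ℕ} (hn : 1 ≤ n)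
    (hle : ∀ p y, T.Adj p y → T.dist v y = T.dist v p + 1 → n ≤ T.dist v y →
      rigid c F (branch T p y) ≤ H) {g : T ≃g T} (hg : g ∈ universalGroup c F)
    (hfix : ∀ x, T.dist v x ≤ n → g x = x) : g ∈ H := by
  classical
  -- strip off the half-trees at distance `n` one at a time
  have main : ∀ s : Finset V, ∀ g ∈ universalGroup c F, (∀ x, T.dist v x ≤ n → g x = x) →
      (∀ p y, T.Adj p y → T.dist v y = n → T.dist v p + 1 = n → y ∉ s →
        ∀ x ∈ branch T p y, g x = x) → g ∈ H := by
    intro s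
    induction s using Finset.induction_on with
    | empty =>
      intro g hg hfix hbr
      have : g = 1 := by
        refine RelIso.ext fun x => ?_
        rcases le_total (T.dist v x) n with hx | hx
        · exact hfix x hx
        · obtain ⟨p, y, h, hy, hp, hxy⟩ := exists_ancestor hT hn hx
          exact hbr p y h hy hp (Finset.notMem_empty y) x hxy
      rw [this]
      exact one_mem H
    | insert y s hys ih =>
      intro g hg hfix hbr
      by_cases hy : ∃ p, T.Adj p y ∧ T.dist v y = n ∧ T.dist v p + 1 = n
      · obtain ⟨p, hpy, hy, hp⟩ := hy
        obtain ⟨r, hr, hrg⟩ := exists_restrict c hT hpy hg (hfix p (by omega)) (hfix y hy.le)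
        have hrx : ∀ x, g x = x → r x = x := by
          intro x hx
          by_cases hxy : x ∈ branch T p y
          · rw [hrg x hxy, hx]
          · exact hr.2 x hxy
        have hinv : ∀ x, g x = x → (r⁻¹ * g) x = x := by
          intro x hx
          rw [RelIso.mul_apply, hx]
          conv_lhs => rw [← hrx x hx]
          exact RelIso.inv_apply_self r x
        have h1 : r⁻¹ * g ∈ H := by
          refine ih _ (mul_mem (inv_mem hr.1) hg) (fun x hx => hinv x (hfix x hx)) ?_
          intro p' y' hpy' hy' hp' hys' x hx
          by_cases hyy : y' = y
          · subst hyy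
            have hpp := parent_unique hT (v := v) hpy'.symm hpy.symm (by omega) (by omega)
            subst hpp
            rw [RelIso.mul_apply, ← hrg x hx, RelIso.inv_apply_self]
          · exact hinv x (hbr p' y' hpy' hy' hp' (by simp [hyy, hys']) x hx)
        have h2 := mul_mem (hle p y hpy (by omega) hy.ge hr) h1
        rwa [mul_inv_cancel_left] at h2
      · refine ih g hg hfix fun p' y' hpy' hy' hp' hys' x hx => ?_
        refine hbr p' y' hpy' hy' hp' ?_ x hx
        rw [Finset.mem_insert, not_or]
        exact ⟨fun e => hy ⟨p', e ▸ hpy', e ▸ hy', hp'⟩, hys'⟩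
  refine main (finite_ball hT c v n).toFinset g hg hfix fun p y _ hy _ hys => ?_
  exact absurd ((finite_ball hT c v n).mem_toFinset.2 hy.le) hys

/-- If `H` has an infinite orbit and contains the groups of all half-trees pointing away from `v`
and sufficiently far from it, then it contains `U(F)⁺`: translating by an element of `H` moving `v`
far away, `H` contains the groups of both half-trees at some edges. -/
theorem plus_le_of_infinite_orbit (hF : IsTwoTransitive F) (hd : 3 ≤ d)
    (hgen : ∀ K : Subgroup (Equiv.Perm (Fin d)), (∀ σ ∈ F, ∀ i, σ i = i → σ ∈ K) → F ≤ K)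
    {H : Subgroup (T ≃g T)} (hHU : H ≤ universalGroup c F) {v : V} {n : ℕ}
    (hle : ∀ p y, T.Adj p y → T.dist v y = T.dist v p + 1 → n ≤ T.dist v y →
      rigid c F (branch T p y) ≤ H) (hv : {x | ∃ g ∈ H, g v = x}.Infinite) :
    universalGroupPlus c F ≤ H := by
  obtain ⟨h, hh, hfar⟩ : ∃ h ∈ H, 2 * n + 3 < T.dist v (h v) := by
    by_contra! hno
    refine hv ((finite_ball hT c v (2 * n + 3)).subset ?_)
    rintro _ ⟨g, hg, rfl⟩
    exact hno g hg
  obtain ⟨y₂, y₃, h₂₃, hy₃, hy₂, hb₂⟩ := exists_ancestor hT (v := v) (x := h v) (n := n + 3)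
    (by omega) (by omega)
  obtain ⟨y₁, h₂₁, hy₁⟩ := exists_parent hT (v := v) (x := y₂) (by
    rintro rfl
    simp at hy₂)
  obtain ⟨y₀, h₁₀, hy₀⟩ := exists_parent hT (v := v) (x := y₁) (by
    rintro rfl
    rw [SimpleGraph.dist_self] at hy₁
    omega)
  have h31 : y₃ ≠ y₁ := by
    rintro rfl
    omega
  have h20 : y₂ ≠ y₀ := by
    rintro rfl
    omega
  have hb₁ := branch_child_subset hT h₂₁.symm h₂₃ h31 hb₂
  have hb₀ := branch_child_subset hT h₁₀.symm h₂₁.symm h20 hb₁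
  have key : ∀ q r, T.Adj q r → T.dist v r = T.dist v q + 1 → n ≤ T.dist v r →
      T.dist v r ≤ n + 3 → h v ∈ branch T q r →
      ∀ g ∈ universalGroup c F, g q = q → g r = r → g ∈ H := by
    intro q r hqr hdr hnr hr hmem g hg hgq hgr
    refine mem_of_fixes_edge c hT hqr (hle q r hqr hdr hnr) (fun b hb => ?_) hg hgq hgr
    have h1 : ∀ x, T.dist v (h⁻¹ x) = T.dist (h v) x := fun x => by
      rw [← dist_map h, RelIso.apply_inv_self]
    have h2 := dist_of_mem_branch hT hqr hmem
    have h3 := hT.connected.dist_triangle (u := v) (v := q) (w := h v)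
    rw [SimpleGraph.dist_comm (u := q) (v := h v)] at h3
    have h4 := hle (h⁻¹ r) (h⁻¹ q) (adj_map h⁻¹ hqr.symm) (by rw [h1, h1, h2])
      (by rw [h1]; omega) (conj_mem_rigid_branch c (inv_mem (hHU hh)) hb)
    have h5 := mul_mem (mul_mem hh h4) (inv_mem hh)
    rwa [show h * (h⁻¹ * b * h⁻¹⁻¹) * h⁻¹ = b by group] at h5
  have key₀ := key y₀ y₁ h₁₀.symm (by omega) (by omega) (by omega) hb₀
  have key₁ := key y₁ y₂ h₂₁.symm (by omega) (by omega) (by omega) hb₁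
  have key₂ := key y₂ y₃ h₂₃ (by omega) (by omega) (by omega) hb₂
  exact plus_le_of_stabilizers c hT hF hd hgen h₂₁.symm
    (fun g hg hg1 => stabilizer_le_of_two_edges c hT hF hd h₁₀ h₂₁.symm h20.symm
      (fun k hk e1 e0 => key₀ k hk e0 e1) key₁ hg hg1)
    (fun g hg hg2 => stabilizer_le_of_two_edges c hT hF hd h₂₁ h₂₃ h31.symm
      (fun k hk e2 e1 => key₁ k hk e1 e2) key₂ hg hg2)

/-- A commensurated subgroup with an infinite orbit is `U(F)⁺`, and one with finite orbits is
finite or contains the pointwise stabilizer of a ball. -/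
theorem finite_or_plus_le_or_fixes_ball (hF : IsTwoTransitive F) (hd : 3 ≤ d)
    (hgen : ∀ K : Subgroup (Equiv.Perm (Fin d)), (∀ σ ∈ F, ∀ i, σ i = i → σ ∈ K) → F ≤ K)
    (hperf : ∀ i, ⁅pointStabilizer F i, pointStabilizer F i⁆ = pointStabilizer F i)
    {H : Subgroup (T ≃g T)} (hHU : H ≤ universalGroup c F)
    (hH : Commensurates (universalGroupPlus c F) H) (v : V) :
    (H : Set (T ≃g T)).Finite ∨ universalGroupPlus c F ≤ H ∨
      {x | ∃ g ∈ H, g v = x}.Finite ∧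
        ∃ n, ∀ g ∈ universalGroup c F, (∀ x, T.dist v x ≤ n → g x = x) → g ∈ H := by
  by_cases hbdd : ∀ v, {x | ∃ g ∈ H, g v = x}.Finite
  · by_cases hnt : ∀ v w, T.Adj v w → ∃ h ∈ H, h ∈ rigid c F (branch T v w) ∧ h ≠ 1
    · obtain ⟨v₀, w₀, h₀, hcomm⟩ := exists_commutator_mem_of_nontrivial c hT hd hH hnt
      obtain ⟨n, hn, hle⟩ := exists_depth c hT hF hd hgen hperf hH h₀
        (rigid_branch_le_of_commutators c hT hF hd hperf h₀ hcomm) v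
      exact Or.inr (Or.inr ⟨hbdd v, n, fun g hg hfix => mem_of_fixes_ball c hT hn hle hg hfix⟩)
    · push Not at hnt
      obtain ⟨v₀, w₀, h₀, htriv⟩ := hnt
      exact Or.inl (finite_of_inter_rigid_trivial c hT hF hd hgen hHU hH hbdd h₀ htriv)
  · push Not at hbdd
    obtain ⟨u, hu⟩ := hbdd
    obtain ⟨w, hw, s, hs, hdis⟩ := exists_disjoint_translates hT c hd hu
    obtain ⟨n, -, hle⟩ := exists_depth c hT hF hd hgen hperf hH hw
      (rigid_branch_le_of_commutators c hT hF hd hperf hw fun a ha b hb =>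
        commutator_mem_of_disjoint_translates c hT hHU hH hw hs hdis ha hb) u
    exact Or.inr (Or.inl (plus_le_of_infinite_orbit c hT hF hd hgen hHU hle hu))

/-- A subgroup of `U(F)` which has a finite orbit and contains the pointwise stabilizer of a ball
is compact. -/
theorem isCompact_of_fixes_ball {H : Subgroup (T ≃g T)} (hHU : H ≤ universalGroup c F) {v : V}
    (hv : {x | ∃ g ∈ H, g v = x}.Finite) {n : ℕ}
    (hn : ∀ g ∈ universalGroup c F, (∀ x, T.dist v x ≤ n → g x = x) → g ∈ H) :
    IsCompact (H : Set (T ≃g T)) := by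
  refine (isCompact_setOf_apply_mem hT c v hv).of_isClosed_subset ?_ fun g hg => ⟨g, hg, rfl⟩
  refine isClosed_iff_frequently.2 fun g hg => ?_
  have hgU : g ∈ universalGroup c F :=
    isClosed_iff_frequently.1 (isClosed_universalGroup c) g (hg.mono fun k hk => hHU hk)
  have h1 : ∀ᶠ k in 𝓝 g, ∀ x ∈ {x | T.dist v x ≤ n}, k x = g x :=
    (Filter.eventually_all_finite (finite_ball hT c v n)).2 fun x _ => eventually_eval_eq g x
  obtain ⟨k, hk, hkg⟩ := (hg.and_eventually h1).exists
  have h2 : k⁻¹ * g ∈ H := hn _ (mul_mem (inv_mem (hHU hk)) hgU) fun x hx => by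
    rw [RelIso.mul_apply, ← hkg x hx, RelIso.inv_apply_self]
  have h3 := mul_mem hk h2
  rwa [mul_inv_cancel_left] at h3

end Tree

theorem pointStabilizer_eq_map (i : Fin d) :
    pointStabilizer F i = (MulAction.stabilizer F i).map F.subtype := by
  ext σ
  constructor
  · rintro ⟨h2, h3⟩
    exact ⟨⟨σ, h2⟩, h3, rfl⟩
  · rintro ⟨τ, h2, rfl⟩
    exact ⟨τ.2, h2⟩

theorem commutator_pointStabilizer_eq {i : Fin d} (h : Group.IsPerfect (MulAction.stabilizer F i)) :
    ⁅pointStabilizer F i, pointStabilizer F i⁆ = pointStabilizer F i := by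
  rw [pointStabilizer_eq_map, ← Subgroup.map_commutator, Subgroup.isPerfect_iff.1 h]

theorem IsTwoTransitive.of_isMultiplyPretransitive
    (h : MulAction.IsMultiplyPretransitive F (Fin d) 2) : IsTwoTransitive F := by
  intro i j k l hij hkl
  obtain ⟨σ, hσ⟩ := MulAction.is_two_pretransitive_iff.1 h hij hkl
  exact ⟨σ, σ.2, hσ⟩

theorem le_of_iSup_stabilizer_eq_top (h : ⨆ i : Fin d, MulAction.stabilizer F i = ⊤)
    (K : Subgroup (Equiv.Perm (Fin d))) (hK : ∀ σ ∈ F, ∀ i, σ i = i → σ ∈ K) : F ≤ K := by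
  rw [← Subgroup.subgroupOf_eq_top, eq_top_iff, ← h]
  exact iSup_le fun i σ hσ => hK σ σ.2 i hσ

theorem isOpen_of_fixes_ball (hT : T.IsTree) (H : Subgroup (universalGroupPlus c F)) {v : V} {n : ℕ}
    (hn : ∀ g : universalGroupPlus c F, (∀ x, T.dist v x ≤ n → (g : T ≃g T) x = x) → g ∈ H) :
    IsOpen (H : Set (universalGroupPlus c F)) := by
  refine Subgroup.isOpen_of_mem_nhds H (g := 1) ?_
  have h1 : ∀ᶠ k in 𝓝 ((1 : universalGroupPlus c F) : T ≃g T),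
      ∀ x ∈ {x | T.dist v x ≤ n}, k x = x :=
    (Filter.eventually_all_finite (finite_ball hT c v n)).2 fun x _ => eventually_eval_eq 1 x
  filter_upwards [continuous_subtype_val.continuousAt.eventually h1] with k hk
  exact hn k hk

theorem Commensurates.of_isCommensurated {Γ : Type*} [Group Γ] {G : Subgroup Γ} {H : Subgroup G}
    (hH : IsCommensurated H) : Commensurates G (H.map G.subtype) := by
  intro a ha
  have h1 : (⟨a, ha⟩ : G)⁻¹ ∈ Subgroup.Commensurable.commensurator H := by
    rw [show Subgroup.Commensurable.commensurator H = ⊤ from hH]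
    exact Subgroup.mem_top _
  refine ⟨((ConjAct.toConjAct (⟨a, ha⟩ : G)⁻¹ • H) ⊓ H).map G.subtype,
    Subgroup.map_mono inf_le_right, ?_, ?_⟩
  · rw [Subgroup.relIndex_map_map_of_injective _ _ G.subtype_injective,
      Subgroup.inf_relIndex_right]
    exact h1.1
  · rintro _ ⟨k, ⟨hk, -⟩, rfl⟩
    obtain ⟨l, hl, rfl⟩ := hk
    refine ⟨l, hl, ?_⟩
    simp [ConjAct.smul_def, mul_assoc]

end

end BurgerMozes

theorem mainTheorem6 {V : Type*} (T : SimpleGraph V) (hT : T.IsTree)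
    (d : ℕ) (hd : 6 ≤ d) (hreg : ∀ v : V, (T.neighborSet v).ncard = d)
    (c : BurgerMozes.Coloring T d)
    (F : Subgroup (Equiv.Perm (Fin d)))
    (hperf : Group.IsPerfect F)
    (htrans : MulAction.IsMultiplyPretransitive F (Fin d) 2)
    (hgen : ⨆ i : Fin d, MulAction.stabilizer F i = ⊤)
    (hstab : ∀ i : Fin d, Group.IsPerfect (MulAction.stabilizer F i))
    (H : Subgroup (BurgerMozes.universalGroupPlus c F))
    (hH : BurgerMozes.IsCommensurated H) :
    (H : Set (BurgerMozes.universalGroupPlus c F)).Finite ∨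
      (IsCompact (H : Set (BurgerMozes.universalGroupPlus c F)) ∧
        IsOpen (H : Set (BurgerMozes.universalGroupPlus c F))) ∨
      H = ⊤ := by
  obtain ⟨v⟩ := hT.connected.nonempty
  have hmem : ∀ g : BurgerMozes.universalGroupPlus c F,
      (g : T ≃g T) ∈ H.map (BurgerMozes.universalGroupPlus c F).subtype ↔ g ∈ H := fun g =>
    Subgroup.mem_map_iff_mem (Subgroup.subtype_injective _)
  have hHU := (Subgroup.map_subtype_le H).trans (BurgerMozes.plus_le c)
  rcases BurgerMozes.finite_or_plus_le_or_fixes_ball c hT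
    (BurgerMozes.IsTwoTransitive.of_isMultiplyPretransitive htrans) (by omega)
    (BurgerMozes.le_of_iSup_stabilizer_eq_top hgen)
    (fun i => BurgerMozes.commutator_pointStabilizer_eq (hstab i)) hHU
    (BurgerMozes.Commensurates.of_isCommensurated hH) v with h | h | ⟨hv, n, hn⟩
  · left
    rw [Subgroup.coe_map] at h
    exact h.of_finite_image (Subgroup.subtype_injective _).injOn
  · right; right
    exact eq_top_iff.2 fun g _ => (hmem g).1 (h g.2)
  · right; left
    refine ⟨?_, BurgerMozes.isOpen_of_fixes_ball c hT H fun g hg =>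
      (hmem g).1 (hn g (BurgerMozes.plus_le c g.2) hg)⟩
    rw [Topology.IsInducing.subtypeVal.isCompact_iff]
    -- the image of `H` under the inclusion into `Aut(T)` is definitionally `H.map`
    exact BurgerMozes.isCompact_of_fixes_ball c hT hHU hv hn
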